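/- Let $G=(V,E)$ be a directed graph with $V=\{1,\dots,n\}$, and fix an instance of one of three diffusion models: discrete-time independent cascade (DIC, edge probabilities in $[0,1]$), discrete-time linear threshold (DLT, nonnegative weights, total weight into each node at most $1$, independent uniform thresholds in $[0,1]$), or continuous-time independent cascade (CIC, independent delays in $[0,\infty]$ with arbitrary laws, finite observation window $[0,\tau]$). For a seed set $S$ let $\mathcal D_S$ be the law of the final active set and $F^*_v(S)=\Pr_{A\sim\mathcal D_S}[v\in A]$. (0) For each node $v$ there is a distribution $\Gamma_v$ over subgraphs $L$ of $G$ such that, for every $S$, $F^*_v(S)$ is the probability that some node of $S$ has a path to $v$ in $L$. Let $\gamma_v$ be the law of the set of all nodes that have a path to $v$ in $L\sim\Gamma_v$. (1) A training set consists of $M$ independent incomplete cascades $(S_i,\tilde A_i)$: $S_i$ is drawn from a distribution $\mathcal P$ over seed sets, $A_i\sim\mathcal D_{S_i}$, and $\tilde A_i$ contains all of $S_i$ and each node of $A_i\setminus S_i$ independently with probability $r\in(0,1]$. For each $v$, let $q_v$ be a distribution over node sets with $\gamma_v(T)\le C\,q_v(T)$ for all $T$, and draw $K$ independent features $T_{v,1},\dots,T_{v,K}\sim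 q_v$, independently of the training set. For $\beta$ in the probability simplex of $\mathbb R^K$ put $$F_v^{\beta,\lambda}(S)=(1-2\lambda)\sum_{k=1}^K\beta_k\min\{|S\cap T_{v,k}|,1\}+\lambda ,$$ and let $\tilde\beta_v$ be any maximizer over the simplex of $\sum_{i=1}^M\tilde\ell\big(F_v^{\beta,\lambda}(S_i),\mathbf 1[v\in\tilde A_i]\big)$, where $\tilde\ell(t,y)=\frac yr\log t+\big(1-\frac yr\big)\log(1-t)$ is the noise-corrected log-likelihood. There are universal constants $c_0>2$, $c_1>0$, $p_1\in\mathbb N$, and for every $a\in\mathbb N$ constants $c_2>0$, $p_2\in\mathbb N$ depending only on $a$, such that for all the data above and all $\varepsilon,\delta\in(0,1)$ the following holds with $\lambda=\varepsilon/(c_0(1+\log\frac1\varepsilon))$, $\Lambda=\log\frac{3n}{\varepsilon\delta}$ and $K_0=c_1\frac{C^2}{\varepsilon^2}\Lambda^{p_1}$. If $$K_0\le K\le K_0^{\,a},\qquad M\ge c_2\,\frac{1+\log C}{\varepsilon^4r^2}\,\Lambda^{p_2},$$ then with probability at least $1-\delta$ (over training set and features), for every node $v$ a maximizer exists and every maximizer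 $\tilde\beta_v$ satisfies $$\mathbb E_{S\sim\mathcal P}\big[(F_v^{\tilde\beta_v,\lambda}(S)-F_v^*(S))^2\big]\le\varepsilon .$$ (2) The three models are improperly PAC learnable from incomplete cascades by such an algorithm: there is one learner for all three models, given $G,r,\varepsilon,\delta$ and the training set, that samples $K\geq 1$ features for each node from laws $q_v$ and outputs truncated functions $F_v^{\beta,\lambda}$, $0<\lambda<1/2$, maximizing the noise-corrected log-likelihood ($q$, $K$, $\lambda$ depend only on $G,r,\varepsilon,\delta$), and such that for each model there are constants $c,d\in\mathbb N$ for which, for all $G$, all parameters of the model, all $\mathcal P$, all $r\in(0,1]$, $\varepsilon,\delta\in(0,1)$ and all $M\ge c\,(n+|E|+\frac1\varepsilon+\frac1\delta+\frac1r)^d$, the output $F$ satisfies $\Pr[\mathrm{err}_{\mathrm{sq}}[F]-\mathrm{err}_{\mathrm{sq}}[F^*]\ge\varepsilon]\le\delta$, where $\mathrm{err}_{\mathrm{sq}}[F]=\mathbb E_{S\sim\mathcal P,\,A\sim\mathcal D_S}\big[\frac1n\sum_v(\mathbf 1[v\in A]-F_v(S))^2\big]$. The learner is improper: its outputs are not all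 influence functions of the model. -/

import Mathlib

open scoped ENNReal NNReal unitInterval
open MeasureTheory

noncomputable section

namespace Influence

/-! ### Probability on finite types -/

/-- The probability of the event `e` under `p`. -/
def prob {α : Type*} (p : PMF α) (e : α → Prop) : ℝ :=
  (p.toOuterMeasure {x | e x}).toReal

/-- The expectation of `f` under `p`. -/
def expect {α : Type*} [Fintype α] (p : PMF α) (f : α → ℝ) : ℝ :=
  ∑ x, (p x).toReal * f x

/-- The law of a random variable with values in a finite type. -/
def lawOf {Ω α : Type*} [MeasurableSpace Ω] [Fintype α] (μ : Measure Ω) [IsProbabilityMeasure μ]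
    (X : Ω → α) (hX : ∀ a, MeasurableSet {ω | X ω = a}) : PMF α :=
  PMF.ofFintype (fun a => μ {ω | X ω = a}) (by
    rw [← measure_biUnion_finset]
    · have h : (⋃ b ∈ (Finset.univ : Finset α), {ω | X ω = b}) = Set.univ := by
        ext ω; simp
      rw [h, measure_univ]
    · intro a _ b _ hab
      refine Set.disjoint_left.mpr ?_
      intro ω (ha : X ω = a) (hb : X ω = b)
      exact hab (ha.symm.trans hb)
    · exact fun a _ => hX a)

/-- The law of independent random variables `x i` with laws `p i`. -/
def productPMF {ι α : Type*} [Fintype ι] [DecidableEq ι] [Fintype α] (p : ι → PMF α) :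
    PMF (ι → α) :=
  PMF.ofFintype (fun x => ∏ i, p i (x i)) (by
    rw [← Fintype.prod_sum (fun i a => p i a)]
    refine Finset.prod_eq_one fun i _ => ?_
    rw [← tsum_fintype (L := .unconditional _), (p i).tsum_coe])

/-- The random subset that contains each `i` independently with probability `p i`. -/
def randomSubset {ι : Type*} [Fintype ι] [DecidableEq ι] (p : ι → I) : PMF (Finset ι) :=
  PMF.ofFintype
    (fun B => ∏ i, if i ∈ B then ENNReal.ofReal (p i) else ENNReal.ofReal (1 - p i)) (by
    have h := Finset.prod_add (fun i => ENNReal.ofReal (p i))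
      (fun i => ENNReal.ofReal (1 - p i)) (Finset.univ : Finset ι)
    have h1 : ∀ i, ENNReal.ofReal (p i) + ENNReal.ofReal (1 - p i) = 1 := by
      intro i
      rw [← ENNReal.ofReal_add (p i).2.1 (sub_nonneg.2 (p i).2.2)]
      simp
    simp only [h1, Finset.prod_const_one, Finset.powerset_univ] at h
    rw [h]
    refine Finset.sum_congr rfl fun B _ => ?_
    rw [Finset.prod_ite]
    congr 1
    · exact Finset.prod_congr (by ext; simp) fun _ _ => rfl
    · exact Finset.prod_congr (by ext; simp) fun _ _ => rfl)

section Graph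

variable {V : Type*} [Fintype V] [DecidableEq V]

/-! ### Diffusion models on a directed graph with node set `V` and edge set `E`

A model with fixed parameters is the map that sends a seed set to the law of the final active set.
-/

open Classical in
/-- The set of nodes that are active at some time. -/
def eventual (A : ℕ → Finset V) : Finset V :=
  Finset.univ.filter fun v => ∃ t, v ∈ A t

/-- The independent cascade: `X` is the set of edges whose (single) activation attempt succeeds.
The state at time `t` is the pair (active nodes, nodes that became active at time `t`). -/
def dicState (E X : Finset (V × V)) (S : Finset V) : ℕ → Finset V × Finset V
  | 0 => (S, S)
  | t + 1 =>
    let A := (dicState E X S t).1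
    let N := (dicState E X S t).2
    let N' := Finset.univ.filter fun v => v ∉ A ∧ ∃ u ∈ N, (u, v) ∈ E ∧ (u, v) ∈ X
    (A ∪ N', N')

/-- Discrete-time independent cascade model with activation probabilities `w`. -/
def dic (E : Finset (V × V)) (w : V × V → I) (S : Finset V) : PMF (Finset V) :=
  (randomSubset w).map fun X => eventual fun t => (dicState E X S t).1

open Classical in
/-- The linear threshold process with thresholds `θ`: the active nodes at time `t`. -/
def dltActive (E : Finset (V × V)) (w : V × V → ℝ) (θ : V → I) (S : Finset V) : ℕ → Finset V
  | 0 => S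
  | t + 1 =>
    dltActive E w θ S t ∪ Finset.univ.filter fun v =>
      (θ v : ℝ) ≤ ∑ u ∈ (dltActive E w θ S t).filter (fun u => (u, v) ∈ E), w (u, v)

/-- An event about a random finite set is measurable as soon as the membership events are. -/
lemma measurableSet_eq_of_mem {Ω : Type*} [MeasurableSpace Ω] {F : Ω → Finset V}
    (h : ∀ v, MeasurableSet {ω | v ∈ F ω}) (A : Finset V) : MeasurableSet {ω | F ω = A} := by
  have : {ω | F ω = A} = ⋂ v, {ω | v ∈ F ω ↔ v ∈ A} := by
    ext ω; simp [Finset.ext_iff]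
  rw [this]
  refine MeasurableSet.iInter fun v => ?_
  by_cases hv : v ∈ A
  · simpa [hv] using h v
  · simp only [hv, iff_false]
    exact (h v).compl

lemma measurableSet_mem_dltActive (E : Finset (V × V)) (w : V × V → ℝ) (S : Finset V) (t : ℕ) :
    ∀ v, MeasurableSet {θ : V → I | v ∈ dltActive E w θ S t} := by
  induction t with
  | zero => intro v; simp [dltActive]
  | succ t ih =>
    intro v
    have : {θ : V → I | v ∈ dltActive E w θ S (t + 1)} =
        {θ | v ∈ dltActive E w θ S t} ∪ ⋃ A : Finset V, {θ | dltActive E w θ S t = A} ∩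
          {θ | (θ v : ℝ) ≤ ∑ u ∈ A.filter (fun u => (u, v) ∈ E), w (u, v)} := by
      ext θ; simp [dltActive]
    rw [this]
    refine (ih v).union (MeasurableSet.iUnion fun A => (measurableSet_eq_of_mem ih A).inter ?_)
    exact measurableSet_le (measurable_subtype_coe.comp (measurable_pi_apply v)) measurable_const

lemma measurableSet_dlt (E : Finset (V × V)) (w : V × V → ℝ) (S A : Finset V) :
    MeasurableSet {θ : V → I | eventual (dltActive E w θ S) = A} := by
  refine measurableSet_eq_of_mem (fun v => ?_) A
  have : {θ : V → I | v ∈ eventual (dltActive E w θ S)} =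
      ⋃ t, {θ | v ∈ dltActive E w θ S t} := by
    ext θ; simp [eventual]
  rw [this]
  exact MeasurableSet.iUnion fun t => measurableSet_mem_dltActive E w S t v

/-- Discrete-time linear threshold model with edge weights `w`; the thresholds are independent and
uniform on `[0, 1]`. -/
def dlt (E : Finset (V × V)) (w : V × V → ℝ) (S : Finset V) : PMF (Finset V) :=
  lawOf (Measure.pi fun _ : V => (volume : Measure I)) (fun θ => eventual (dltActive E w θ S))
    (measurableSet_dlt E w S)

/-- The earliest time at which `v` is activated along a chain of at most `k` activations, given
the delays `d`. -/
def cicTime (E : Finset (V × V)) (d : V × V → ℝ≥0∞) (S : Finset V) : ℕ → V → ℝ≥0∞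
  | 0, v => if v ∈ S then 0 else ⊤
  | k + 1, v =>
    min (cicTime E d S k v) (⨅ u, if (u, v) ∈ E then cicTime E d S k u + d (u, v) else ⊤)

/-- The nodes whose activation time lies in the observation window `[0, τ]`. -/
def cicActive (E : Finset (V × V)) (d : V × V → ℝ≥0∞) (τ : ℝ≥0) (S : Finset V) : Finset V :=
  Finset.univ.filter fun v => (⨅ k, cicTime E d S k v) ≤ (τ : ℝ≥0∞)

lemma measurable_cicTime (E : Finset (V × V)) (S : Finset V) (k : ℕ) :
    ∀ v, Measurable fun d : V × V → ℝ≥0∞ => cicTime E d S k v := by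
  induction k with
  | zero => intro v; simp [cicTime]
  | succ k ih =>
    intro v
    simp only [cicTime]
    refine (ih v).min (Measurable.iInf fun u => ?_)
    by_cases h : (u, v) ∈ E
    · simp only [h, if_true]
      exact (ih u).add (measurable_pi_apply (u, v))
    · simp [h]

lemma measurableSet_cic (E : Finset (V × V)) (τ : ℝ≥0) (S A : Finset V) :
    MeasurableSet {d : V × V → ℝ≥0∞ | cicActive E d τ S = A} := by
  refine measurableSet_eq_of_mem (fun v => ?_) A
  simp only [cicActive, Finset.mem_filter, Finset.mem_univ, true_and]
  exact measurableSet_le (Measurable.iInf fun k => measurable_cicTime E S k v) measurable_const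

/-- Continuous-time independent cascade model: independent delays with laws `delay e` (the value
`∞` means that the activation never happens) and observation window `[0, τ]`. -/
def cic (E : Finset (V × V)) (delay : V × V → ProbabilityMeasure ℝ≥0∞) (τ : ℝ≥0) (S : Finset V) :
    PMF (Finset V) :=
  lawOf (Measure.pi fun e => (delay e : Measure ℝ≥0∞)) (fun d => cicActive E d τ S)
    (measurableSet_cic E τ S)

/-- The three diffusion models. -/
inductive Model
  | DIC
  | DLT
  | CIC

/-- All instances (choices of parameters) of a diffusion model on the graph with edge set `E`. -/
def Model.instances (m : Model) (E : Finset (V × V)) : Set (Finset V → PMF (Finset V)) :=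
  match m with
  | .DIC => {D | ∃ w : V × V → I, D = dic E w}
  | .DLT => {D | ∃ w : V × V → ℝ, (∀ e ∈ E, 0 ≤ w e) ∧
      (∀ v, ∑ u ∈ Finset.univ.filter (fun u => (u, v) ∈ E), w (u, v) ≤ 1) ∧ D = dlt E w}
  | .CIC => {D | ∃ (delay : V × V → ProbabilityMeasure ℝ≥0∞) (τ : ℝ≥0), D = cic E delay τ}

/-- The influence function: the marginal activation probability of `v` for the seed set `S`. -/
def influence (D : Finset V → PMF (Finset V)) (S : Finset V) (v : V) : ℝ :=
  prob (D S) fun A => v ∈ A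

/-! ### Incomplete cascades -/

/-- The observed part of the active set `A` of a cascade with seed set `S`: seeds are always
observed, every other active node independently with probability `r`. -/
def observed (r : I) (S A : Finset V) : PMF (Finset V) :=
  (randomSubset fun _ : V => r).map fun R => S ∪ ((A \ S) ∩ R)

/-- The law of one incomplete cascade (seed set, observed active set). -/
def incompleteCascade (P : PMF (Finset V)) (D : Finset V → PMF (Finset V)) (r : I) :
    PMF (Finset V × Finset V) :=
  P.bind fun S => (D S).bind fun A => (observed r S A).map fun B => (S, B)

/-- The law of `M` independent incomplete cascades. -/
def trainingSet (P : PMF (Finset V)) (D : Finset V → PMF (Finset V)) (r : I) (M : ℕ) :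
    PMF (Fin M → Finset V × Finset V) :=
  productPMF fun _ => incompleteCascade P D r

/-- Squared error of `F` with respect to the true model. -/
def errSq (P : PMF (Finset V)) (D : Finset V → PMF (Finset V)) (F : Finset V → V → ℝ) : ℝ :=
  expect P fun S => expect (D S) fun A =>
    (1 / (Fintype.card V : ℝ)) * ∑ v, ((if v ∈ A then 1 else 0) - F S v) ^ 2

/-! ### Live-edge graphs and the reachability distribution -/

open Classical in
/-- The nodes that have a path to `v` in the live-edge graph `L`. -/
def reachSet (L : Finset (V × V)) (v : V) : Finset V :=
  Finset.univ.filter fun u => Relation.ReflTransGen (fun a b => (a, b) ∈ L) u v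

/-- `Γ` is a distribution over live-edge graphs that describes the activation of `v`. -/
def IsLiveEdgeDist (E : Finset (V × V)) (D : Finset V → PMF (Finset V)) (v : V)
    (Γ : PMF (Finset (V × V))) : Prop :=
  (∀ L ∈ Γ.support, L ⊆ E) ∧
    ∀ S, influence D S v = prob Γ fun L => ∃ u ∈ S, u ∈ reachSet L v

/-- The reachability distribution `γ`: the law of the set of nodes that have a path to `v`. -/
def reachDist (Γ : PMF (Finset (V × V))) (v : V) : PMF (Finset V) :=
  Γ.map fun L => reachSet L v

/-! ### The learning algorithm -/

/-- The indicator vector of a set of nodes. -/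
def charVec (T : Finset V) : V → ℝ := fun u => if u ∈ T then 1 else 0

/-- The function `∑ k, β k * min {χ_S ⬝ χ_{T k}, 1}`. -/
def reachFun {K : ℕ} (T : Fin K → Finset V) (β : Fin K → ℝ) (S : Finset V) : ℝ :=
  ∑ k, β k * min (charVec S ⬝ᵥ charVec (T k)) 1

/-- The truncated function `(1 - 2 lam) f + lam`. -/
def truncFun {K : ℕ} (lam : ℝ) (T : Fin K → Finset V) (β : Fin K → ℝ) (S : Finset V) : ℝ :=
  (1 - 2 * lam) * reachFun T β S + lam

/-- The noise-corrected log-likelihood. It is the only function of `t` and `y ∈ {0, 1}` with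
`r * ℓ(t, 1) + (1 - r) * ℓ(t, 0) = log t` and `ℓ(t, 0) = log (1 - t)`, that is, the unbiased
estimator of the log-likelihood when a label `1` is kept with probability `r`. -/
def corrLogLik (r t y : ℝ) : ℝ :=
  y / r * Real.log t + (1 - y / r) * Real.log (1 - t)

/-- The corrected log-likelihood of the weights `β` for node `v` on the sample `s`. -/
def objective {K M : ℕ} (r lam : ℝ) (T : Fin K → Finset V) (s : Fin M → Finset V × Finset V)
    (v : V) (β : Fin K → ℝ) : ℝ :=
  ∑ i, corrLogLik r (truncFun lam T β (s i).1) (if v ∈ (s i).2 then 1 else 0)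

/-- `β` is a solution of the constrained maximum-likelihood problem for node `v`. -/
def IsFit {K M : ℕ} (r lam : ℝ) (T : Fin K → Finset V) (s : Fin M → Finset V × Finset V)
    (v : V) (β : Fin K → ℝ) : Prop :=
  β ∈ stdSimplex ℝ (Fin K) ∧ IsMaxOn (objective r lam T s v) (stdSimplex ℝ (Fin K)) β

/-- For every node `v`, independent features `T v 1, …, T v K` with law `q v`. -/
def featureLaw (q : V → PMF (Finset V)) (K : ℕ) : PMF (V → Fin K → Finset V) :=
  productPMF fun v => productPMF fun _ => q v

/-- The law of the training set and the (independently drawn) features. -/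
def experiment (P : PMF (Finset V)) (D : Finset V → PMF (Finset V)) (r : I)
    (q : V → PMF (Finset V)) (M K : ℕ) :
    PMF ((Fin M → Finset V × Finset V) × (V → Fin K → Finset V)) :=
  (trainingSet P D r M).bind fun s => (featureLaw q K).map fun T => (s, T)

end Graph

/-- The truncation parameter `ε / (c (1 + log (1 / ε)))` for the accuracy `ε`. -/
def truncLevel (c ε : ℝ) : ℝ := ε / (c * (1 + Real.log (1 / ε)))

/-- The logarithmic term `log (3 n / (ε δ))`. -/
def logTerm (n : ℕ) (ε δ : ℝ) : ℝ := Real.log (3 * n / (ε * δ))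

/-! ### PAC learnability -/

/-- A (randomized) learner. It knows the graph, the retention rate `r`, the accuracy `ε`, the
confidence `δ` and the training set, and outputs an influence function. -/
abbrev Learner : Type :=
  ∀ (n : ℕ) (_ : Finset (Fin n × Fin n)) (_ : I) (_ _ : ℝ) (M : ℕ)
    (_ : Fin M → Finset (Fin n) × Finset (Fin n)), PMF (Finset (Fin n) → Fin n → ℝ)

/-- The learner PAC learns the influence functions of the model `m` from incomplete cascades, with
polynomial sample complexity. -/
def Learner.PACLearns (L : Learner) (m : Model) : Prop :=
  ∃ c d : ℕ, ∀ (n : ℕ) (E : Finset (Fin n × Fin n)) (r : I) (ε δ : ℝ),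
    0 < r → 0 < ε → ε < 1 → 0 < δ → δ < 1 →
    ∀ D ∈ m.instances E, ∀ (P : PMF (Finset (Fin n))) (M : ℕ),
      (c : ℝ) * (n + E.card + 1 / ε + 1 / δ + 1 / (r : ℝ)) ^ d ≤ M →
      prob ((trainingSet P D r M).bind (L n E r ε δ M))
        (fun F => ε ≤ errSq P D F - errSq P D (influence D)) ≤ δ

/-- Every function that the learner can output is an influence function of the model `m`. -/
def Learner.IsProper (L : Learner) (m : Model) : Prop :=
  ∀ (n : ℕ) (E : Finset (Fin n × Fin n)) (r : I) (ε δ : ℝ),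
    0 < r → 0 < ε → ε < 1 → 0 < δ → δ < 1 →
    ∀ (M : ℕ) (s : Fin M → Finset (Fin n) × Finset (Fin n)),
      ∀ F ∈ (L n E r ε δ M s).support, ∃ D ∈ m.instances E, F = influence D

/-- The learner samples reachability features and maximizes the noise-corrected log-likelihood over
the truncated functions. The feature law `q`, the number of features `K` and the truncation `lam`
depend only on what the learner knows before it sees the sample. -/
def Learner.IsTruncatedML (L : Learner) : Prop :=
  ∀ (n : ℕ) (E : Finset (Fin n × Fin n)) (r : I) (ε δ : ℝ),
    0 < r → 0 < ε → ε < 1 → 0 < δ → δ < 1 →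
    ∃ (q : Fin n → PMF (Finset (Fin n))) (K : ℕ) (lam : ℝ), 0 < K ∧ 0 < lam ∧ lam < 1 / 2 ∧
      ∀ (M : ℕ) (s : Fin M → Finset (Fin n) × Finset (Fin n)),
        ∃ sel : (Fin n → Fin K → Finset (Fin n)) → Fin n → Fin K → ℝ,
          (∀ T v, IsFit (r : ℝ) lam (T v) s v (sel T v)) ∧
          L n E r ε δ M s =
            (featureLaw q K).map fun T S v => truncFun lam (T v) (sel T v) S

end Influence

end

open scoped ENNReal NNReal unitInterval
open Influence

namespace Influence

open MeasureTheory ProbabilityTheory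

/-! ### Probabilities and expectations -/

section Prob

variable {α β : Type*}

/-! Live-edge laws. In the discrete independent cascade, the live graph consists of the successful
edges. In continuous time, keep the edges both of whose ends reach `v` within the window: every edge
of a fast enough chain to `v` qualifies, and conversely the first edge of a live path already
certifies that its start reaches `v` in time (`mem_cicActive_iff_reach`). For linear thresholds, let
each node choose at most one in-neighbour, `u` with probability `w (u, v)`. For every active set
both rules hold with the same probability; being monotone and independent across nodes, they produce
the same law of histories (`measure_progressive_eq`).

Accuracy of the fit. The influence on `v` is the mean, under the reachability law `γ`, of the
indicator that a random set meets `S`. Features drawn from `q`, weighted by `γ / q ≤ C` and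
normalised, give a combination β' that is within `lam` of the influence off a small exceptional set
of seed sets (`prob_not_isApproximable_le`, by Hoeffding and Markov). Bounding relative entropy by
chi-square controls the excess log-loss of β', and a Pinsker inequality turns the excess log-loss of
a maximizer into squared error.

It remains to compare empirical and expected log-likelihood uniformly over the simplex. A point of
the simplex is a law on indices, and replacing it by the average over `m` sampled indices changes
the log-likelihood by order `1 / (m * lam)` (`sum_logLik_le`). The rate is not `1 / (m * lam ^ 2)`
because the variance of the truncated average is at most its mean over `m`. Only `K ^ m` averages
remain for Hoeffding and a union bound, so `m` of order `Λ / ε ^ 2` and `M` of order `m * log K / (ε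
* r) ^ 2`, up to logarithms, suffice; `C` enters `M` only through its logarithm.

The correction is biased on cascades with `v` among the seeds, since seeds are never lost. There β'
takes the largest admissible value `1 - lam`, so the bias can only favour β', and a maximizer still
beats β' in unbiased log-likelihood (`IsFit.sum_logLik_le`).

Learnability. Uniform features satisfy the density bound with `C = 2 ^ n` whatever the model is, and
`log C` is linear in `n`. The outputs are improper because they equal `lam > 0` at the empty seed
set. -/

lemma sum_toReal_eq_one [Fintype α] (p : PMF α) : ∑ x, (p x).toReal = 1 := by
  rw [← ENNReal.toReal_sum fun x _ => p.apply_ne_top x, ← tsum_fintype (L := .unconditional _),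
    p.tsum_coe, ENNReal.toReal_one]

lemma prob_eq_expect [Fintype α] (p : PMF α) (e : α → Prop) [DecidablePred e] :
    prob p e = expect p fun x => if e x then 1 else 0 := by
  rw [prob, PMF.toOuterMeasure_apply_fintype, ENNReal.toReal_sum, expect]
  · refine Finset.sum_congr rfl fun x _ => ?_
    by_cases h : e x <;> simp [h]
  · intro x _
    by_cases h : e x <;> simp [h, p.apply_ne_top x]

lemma prob_nonneg (p : PMF α) (e : α → Prop) : 0 ≤ prob p e := ENNReal.toReal_nonneg

lemma prob_map (p : PMF α) (f : α → β) (e : β → Prop) :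
    prob (p.map f) e = prob p fun x => e (f x) := by
  rw [prob, PMF.toOuterMeasure_map_apply]
  rfl

lemma expect_bind [Fintype α] [Fintype β] (p : PMF α) (f : α → PMF β) (g : β → ℝ) :
    expect (p.bind f) g = expect p fun a => expect (f a) g := by
  simp only [expect, PMF.bind_apply, tsum_fintype, Finset.mul_sum]
  rw [Finset.sum_comm]
  refine Finset.sum_congr rfl fun b _ => ?_
  rw [ENNReal.toReal_sum fun a _ => ENNReal.mul_ne_top (p.apply_ne_top a) ((f a).apply_ne_top b),
    Finset.sum_mul]
  refine Finset.sum_congr rfl fun a _ => ?_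
  rw [ENNReal.toReal_mul, mul_assoc]

lemma expect_pure [Fintype α] (a : α) (g : α → ℝ) : expect (PMF.pure a) g = g a := by
  classical
  rw [expect, Finset.sum_eq_single a]
  · simp
  · intro b _ hb
    simp [PMF.pure_apply, hb]
  · simp

lemma expect_map [Fintype α] [Fintype β] (p : PMF α) (f : α → β) (g : β → ℝ) :
    expect (p.map f) g = expect p fun a => g (f a) := by
  rw [PMF.map, expect_bind]
  exact congrArg _ (funext fun a => expect_pure _ _)

variable [Fintype α] (p : PMF α)

lemma expect_const (c : ℝ) : expect p (fun _ => c) = c := by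
  rw [expect, ← Finset.sum_mul, sum_toReal_eq_one, one_mul]

lemma expect_mono_of_ne_zero {f g : α → ℝ} (h : ∀ x, p x ≠ 0 → f x ≤ g x) :
    expect p f ≤ expect p g := by
  refine Finset.sum_le_sum fun x _ => ?_
  by_cases hx : p x = 0
  · simp [hx]
  · exact mul_le_mul_of_nonneg_left (h x hx) ENNReal.toReal_nonneg

lemma expect_mono {f g : α → ℝ} (h : ∀ x, f x ≤ g x) : expect p f ≤ expect p g :=
  expect_mono_of_ne_zero p fun x _ => h x

lemma expect_congr_of_ne_zero {f g : α → ℝ} (h : ∀ x, p x ≠ 0 → f x = g x) :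
    expect p f = expect p g :=
  le_antisymm (expect_mono_of_ne_zero p fun x hx => (h x hx).le)
    (expect_mono_of_ne_zero p fun x hx => (h x hx).ge)

lemma expect_nonneg {f : α → ℝ} (h : ∀ x, 0 ≤ f x) : 0 ≤ expect p f :=
  (expect_const p 0).symm.le.trans (expect_mono p h)

lemma expect_le {f : α → ℝ} {c : ℝ} (h : ∀ x, f x ≤ c) : expect p f ≤ c :=
  (expect_mono p h).trans (expect_const p c).le

lemma le_expect {f : α → ℝ} {c : ℝ} (h : ∀ x, c ≤ f x) : c ≤ expect p f :=
  (expect_const p c).symm.le.trans (expect_mono p h)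

lemma expect_add (f g : α → ℝ) : expect p (fun x => f x + g x) = expect p f + expect p g := by
  simp [expect, mul_add, Finset.sum_add_distrib]

lemma expect_sub (f g : α → ℝ) : expect p (fun x => f x - g x) = expect p f - expect p g := by
  simp [expect, mul_sub, Finset.sum_sub_distrib]

lemma expect_const_mul (c : ℝ) (f : α → ℝ) : expect p (fun x => c * f x) = c * expect p f := by
  simp only [expect, Finset.mul_sum]
  exact Finset.sum_congr rfl fun x _ => by ring

lemma expect_sum {ι : Type*} (s : Finset ι) (f : ι → α → ℝ) :
    expect p (fun x => ∑ i ∈ s, f i x) = ∑ i ∈ s, expect p (f i) := by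
  simp only [expect, Finset.mul_sum]
  exact Finset.sum_comm

lemma expect_comm [Fintype β] (q : PMF β) (f : α → β → ℝ) :
    expect p (fun x => expect q (f x)) = expect q fun y => expect p fun x => f x y := by
  simp only [expect, Finset.mul_sum]
  rw [Finset.sum_comm]
  exact Finset.sum_congr rfl fun y _ => Finset.sum_congr rfl fun x _ => by ring

lemma prob_mono_of_ne_zero {e e' : α → Prop} (h : ∀ x, p x ≠ 0 → e x → e' x) :
    prob p e ≤ prob p e' := by
  classical
  rw [prob_eq_expect, prob_eq_expect]
  refine expect_mono_of_ne_zero p fun x hx => ?_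
  have := h x hx
  split_ifs <;> simp_all

lemma prob_mono {e e' : α → Prop} (h : ∀ x, e x → e' x) : prob p e ≤ prob p e' :=
  prob_mono_of_ne_zero p fun x _ => h x

lemma prob_le_one (e : α → Prop) : prob p e ≤ 1 := by
  classical
  rw [prob_eq_expect]
  exact expect_le p fun x => by split_ifs <;> simp

lemma prob_not (e : α → Prop) : prob p (fun x => ¬ e x) = 1 - prob p e := by
  classical
  rw [prob_eq_expect, prob_eq_expect, ← expect_const p 1, ← expect_sub, expect_const]
  congr 1
  ext x
  split_ifs <;> simp

lemma prob_or_le (e e' : α → Prop) : prob p (fun x => e x ∨ e' x) ≤ prob p e + prob p e' := by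
  classical
  rw [prob_eq_expect, prob_eq_expect, prob_eq_expect, ← expect_add]
  refine expect_mono p fun x => ?_
  by_cases h : e x <;> by_cases h' : e' x <;> simp [h, h']

lemma prob_exists_le {ι : Type*} [Fintype ι] (e : ι → α → Prop) :
    prob p (fun x => ∃ i, e i x) ≤ ∑ i, prob p (e i) := by
  classical
  simp only [prob_eq_expect]
  rw [← expect_sum]
  refine expect_mono p fun x => ?_
  split_ifs with h
  · obtain ⟨i, hi⟩ := h
    calc (1 : ℝ) = if e i x then 1 else 0 := by simp [hi]
      _ ≤ _ := Finset.single_le_sum (f := fun i => if e i x then (1 : ℝ) else 0)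
        (fun j _ => by split_ifs <;> simp) (Finset.mem_univ i)
  · exact Finset.sum_nonneg fun j _ => by split_ifs <;> simp

/-- Markov's inequality. -/
lemma prob_lt_le_div {f : α → ℝ} (hf : ∀ x, 0 ≤ f x) {c : ℝ} (hc : 0 < c) :
    prob p (fun x => c < f x) ≤ expect p f / c := by
  classical
  rw [prob_eq_expect, le_div_iff₀ hc, mul_comm, ← expect_const_mul]
  refine expect_mono p fun x => ?_
  split_ifs with h
  · simpa using h.le
  · simpa using hf x

lemma prob_bind [Fintype β] (f : α → PMF β) (e : β → Prop) :
    prob (p.bind f) e = expect p fun a => prob (f a) e := by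
  classical
  simp only [prob_eq_expect, expect_bind]

/-! ### Independent random variables -/

variable {ι : Type*} [Fintype ι] [DecidableEq ι]

lemma productPMF_toReal (p : ι → PMF α) (x : ι → α) :
    (productPMF p x).toReal = ∏ i, (p i (x i)).toReal := by
  rw [productPMF, PMF.ofFintype_apply, ENNReal.toReal_prod]

lemma expect_productPMF_prod (p : ι → PMF α) (f : ι → α → ℝ) :
    expect (productPMF p) (fun x => ∏ i, f i (x i)) = ∏ i, expect (p i) (f i) := by
  simp only [expect, productPMF_toReal, ← Finset.prod_mul_distrib]
  exact (Fintype.prod_sum (fun i a => (p i a).toReal * f i a)).symm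

lemma expect_productPMF_eval (p : ι → PMF α) (i : ι) (f : α → ℝ) :
    expect (productPMF p) (fun x => f (x i)) = expect (p i) f := by
  have h := expect_productPMF_prod p (fun j => if j = i then f else fun _ => 1)
  rw [Finset.prod_eq_single i, if_pos rfl] at h
  · rw [← h]
    congr 1
    ext x
    rw [Finset.prod_eq_single i]
    · simp
    · intro j _ hj; simp [hj]
    · simp
  · intro j _ hj; simp [hj, expect_const]
  · simp

lemma prob_productPMF_eval (p : ι → PMF α) (i : ι) (e : α → Prop) :
    prob (productPMF p) (fun x => e (x i)) = prob (p i) e := by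
  classical
  rw [prob_eq_expect, prob_eq_expect]
  exact expect_productPMF_eval p i fun a => if e a then (1 : ℝ) else 0

lemma expect_productPMF_mul (p : ι → PMF α) {i j : ι} (hij : i ≠ j) (f g : α → ℝ) :
    expect (productPMF p) (fun x => f (x i) * g (x j)) = expect (p i) f * expect (p j) g := by
  have h := expect_productPMF_prod p
    (fun k => if k = i then f else if k = j then g else fun _ => 1)
  have key : ∀ F : ι → ℝ, (∀ k, k ≠ i → k ≠ j → F k = 1) → ∏ k, F k = F i * F j := by
    intro F hF
    rw [← Finset.prod_pair hij]
    refine (Finset.prod_subset (Finset.subset_univ _) fun k _ hk => ?_).symm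
    simp only [Finset.mem_insert, Finset.mem_singleton, not_or] at hk
    exact hF k hk.1 hk.2
  rw [key] at h
  · simp only [if_true, if_neg hij.symm] at h
    rw [← h]
    congr 1
    ext x
    rw [key]
    · simp [hij.symm]
    · intro k hk hk'; simp [hk, hk']
  · intro k hk hk'; simp [hk, hk', expect_const]

/-- The variance of a sum of independent identically distributed random variables. -/
lemma expect_productPMF_sum_sq (p : PMF α) (N : ℕ) (f : α → ℝ) (hf : expect p f = 0) :
    expect (productPMF fun _ : Fin N => p) (fun x => (∑ i, f (x i)) ^ 2) =
      N * expect p fun a => f a ^ 2 := by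
  have h : ∀ x : Fin N → α, (∑ i, f (x i)) ^ 2 = ∑ i, ∑ j, f (x i) * f (x j) := by
    intro x; rw [sq, Finset.sum_mul_sum]
  simp only [h, expect_sum]
  have h' : ∀ i : Fin N, ∑ j, expect (productPMF fun _ : Fin N => p) (fun x => f (x i) * f (x j))
      = expect p fun a => f a ^ 2 := by
    intro i
    rw [Finset.sum_eq_single i]
    · simp only [← sq]
      exact expect_productPMF_eval (fun _ => p) i fun a => f a ^ 2
    · intro j _ hj
      rw [expect_productPMF_mul _ hj.symm, hf, zero_mul]
    · simp
  simp [h']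

/-- Hoeffding's lemma. -/
lemma expect_exp_le {f : α → ℝ} {a b : ℝ} (h : ∀ x, p x ≠ 0 → a ≤ f x ∧ f x ≤ b) (s : ℝ) :
    expect p (fun x => Real.exp (s * (f x - expect p f))) ≤
      Real.exp (s ^ 2 * (b - a) ^ 2 / 8) := by
  let _ : MeasurableSpace α := ⊤
  have : DiscreteMeasurableSpace α := ⟨fun _ => trivial⟩
  have hb : ∀ᵐ ω ∂p.toMeasure, f ω ∈ Set.Icc a b := by
    rw [ae_iff, PMF.toMeasure_apply_eq_zero_iff _ (MeasurableSet.of_discrete)]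
    rw [Set.disjoint_left]
    intro x hx hx'
    exact hx' (h x hx)
  have hi : ∀ g : α → ℝ, ∫ x, g x ∂p.toMeasure = expect p g := by
    intro g
    rw [PMF.integral_eq_sum]
    rfl
  have := (hasSubgaussianMGF_of_mem_Icc (μ := p.toMeasure) (X := f)
    (Measurable.of_discrete.aemeasurable) hb).mgf_le s
  rw [mgf, hi, hi] at this
  refine this.trans (Real.exp_le_exp.2 (le_of_eq ?_))
  push_cast
  rw [Real.norm_eq_abs, div_pow, sq_abs]
  ring

/-- Hoeffding's inequality. -/
lemma hoeffding (N : ℕ) {f : α → ℝ} {a b : ℝ} (hab : a < b)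
    (h : ∀ x, p x ≠ 0 → a ≤ f x ∧ f x ≤ b) {t : ℝ} (ht : 0 ≤ t) :
    prob (productPMF fun _ : Fin N => p) (fun x => N * (expect p f + t) ≤ ∑ i, f (x i)) ≤
      Real.exp (-(2 * N * t ^ 2 / (b - a) ^ 2)) := by
  classical
  -- This `s` minimises the Chernoff exponent `N * (s ^ 2 * (b - a) ^ 2 / 8 - s * t)`.
  set s : ℝ := 4 * t / (b - a) ^ 2 with hs
  have hw : 0 < (b - a) ^ 2 := by have := sub_pos.2 hab; positivity
  have hs0 : 0 ≤ s := by positivity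
  have h1 : prob (productPMF fun _ : Fin N => p) (fun x => N * (expect p f + t) ≤ ∑ i, f (x i)) ≤
      expect (productPMF fun _ : Fin N => p)
        (fun x => Real.exp (-(s * (N * t))) * ∏ i, Real.exp (s * (f (x i) - expect p f))) := by
    rw [prob_eq_expect]
    refine expect_mono _ fun x => ?_
    rw [← Real.exp_sum, ← Real.exp_add]
    split_ifs with hx
    · refine Real.one_le_exp ?_
      rw [← Finset.mul_sum, Finset.sum_sub_distrib]
      simp only [Finset.sum_const, Finset.card_univ, Fintype.card_fin, nsmul_eq_mul]
      have : 0 ≤ s * (∑ i, f (x i) - N * (expect p f + t)) := mul_nonneg hs0 (sub_nonneg.2 hx)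
      linarith
    · positivity
  refine h1.trans ?_
  rw [expect_const_mul, expect_productPMF_prod (fun _ : Fin N => p)
    (fun _ y => Real.exp (s * (f y - expect p f)))]
  have h2 : ∏ _i : Fin N, expect p (fun y => Real.exp (s * (f y - expect p f))) ≤
      Real.exp (s ^ 2 * (b - a) ^ 2 / 8) ^ N := by
    simp only [Finset.prod_const, Finset.card_univ, Fintype.card_fin]
    exact pow_le_pow_left₀ (expect_nonneg p fun _ => (Real.exp_pos _).le) (expect_exp_le p h s) N
  refine (mul_le_mul_of_nonneg_left h2 (Real.exp_pos _).le).trans ?_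
  rw [← Real.exp_nat_mul, ← Real.exp_add, Real.exp_le_exp]
  refine le_of_eq ?_
  rw [hs]
  field_simp
  ring

lemma hoeffding_lower (N : ℕ) {f : α → ℝ} {a b : ℝ} (hab : a < b)
    (h : ∀ x, p x ≠ 0 → a ≤ f x ∧ f x ≤ b) {t : ℝ} (ht : 0 ≤ t) :
    prob (productPMF fun _ : Fin N => p) (fun x => ∑ i, f (x i) ≤ N * (expect p f - t)) ≤
      Real.exp (-(2 * N * t ^ 2 / (b - a) ^ 2)) := by
  have h1 := hoeffding p N (f := fun x => -f x) (a := -b) (b := -a) (neg_lt_neg hab)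
    (fun x hx => ⟨neg_le_neg (h x hx).2, neg_le_neg (h x hx).1⟩) ht
  have h2 : expect p (fun x => -f x) = -expect p f := by
    simpa using expect_const_mul p (-1) f
  rw [h2, neg_sub_neg] at h1
  refine le_trans (prob_mono _ fun x hx => ?_) h1
  rw [Finset.sum_neg_distrib]
  linarith

end Prob

/-! ### Live-edge descriptions of the diffusion models -/

lemma prob_lawOf {Ω α : Type*} [MeasurableSpace Ω] [Fintype α] (μ : Measure Ω)
    [IsProbabilityMeasure μ] (X : Ω → α) (hX : ∀ a, MeasurableSet {ω | X ω = a}) (e : α → Prop) :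
    prob (lawOf μ X hX) e = (μ {ω | e (X ω)}).toReal := by
  classical
  have h : {ω | e (X ω)} = ⋃ a ∈ Finset.univ.filter e, {ω | X ω = a} := by
    ext ω; simp
  rw [h, measure_biUnion_finset _ fun a _ => hX a, prob, PMF.toOuterMeasure_apply_fintype,
    Finset.sum_filter]
  · congr 1
  · intro a _ b _ hab
    exact Set.disjoint_left.mpr fun ω (ha : X ω = a) (hb : X ω = b) => hab (ha.symm.trans hb)

section LiveEdge

variable {V : Type*} [Fintype V] [DecidableEq V]

lemma mem_reachSet {L : Finset (V × V)} {u v : V} :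
    u ∈ reachSet L v ↔ Relation.ReflTransGen (fun a b => (a, b) ∈ L) u v := by
  simp [reachSet]

/-! #### Independent cascade -/

lemma dicState_snd_subset (E X : Finset (V × V)) (S : Finset V) (t : ℕ) :
    (dicState E X S t).2 ⊆ (dicState E X S t).1 := by
  cases t with
  | zero => exact subset_rfl
  | succ t => exact Finset.subset_union_right

lemma mem_eventual_dicState (E X : Finset (V × V)) (S : Finset V) (v : V) :
    v ∈ eventual (fun t => (dicState E X S t).1) ↔ ∃ u ∈ S, u ∈ reachSet (E ∩ X) v := by
  simp only [mem_reachSet, eventual, Finset.mem_filter, Finset.mem_univ, true_and]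
  constructor
  · rintro ⟨t, ht⟩
    induction t generalizing v with
    | zero => exact ⟨v, ht, .refl⟩
    | succ t ih =>
      simp only [dicState, Finset.mem_union, Finset.mem_filter, Finset.mem_univ, true_and] at ht
      rcases ht with ht | ⟨_, x, hx, hxE, hxX⟩
      · exact ih v ht
      · obtain ⟨u, hu, hux⟩ := ih x (dicState_snd_subset E X S t hx)
        exact ⟨u, hu, hux.tail (Finset.mem_inter.2 ⟨hxE, hxX⟩)⟩
  -- Only freshly activated nodes try their edges, so a path is followed by returning to the time at
  -- which each of its nodes was fresh.
  · have new : ∀ t x, x ∈ (dicState E X S t).1 → ∃ s, x ∈ (dicState E X S s).2 := by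
      intro t
      induction t with
      | zero => exact fun x hx => ⟨0, hx⟩
      | succ t ih =>
        intro x hx
        rcases Finset.mem_union.1 hx with h | h
        · exact ih x h
        · exact ⟨t + 1, h⟩
    rintro ⟨u, hu, huv⟩
    induction huv with
    | refl => exact ⟨0, hu⟩
    | @tail x y _ hxy ih =>
      obtain ⟨t, ht⟩ := ih
      obtain ⟨s, hs⟩ := new t x ht
      obtain ⟨hE, hX⟩ := Finset.mem_inter.1 hxy
      refine ⟨s + 1, ?_⟩
      by_cases hy : y ∈ (dicState E X S s).1
      · exact Finset.mem_union_left _ hy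
      · exact Finset.mem_union_right _ (by simpa using ⟨hy, x, hs, hE, hX⟩)

lemma exists_isLiveEdgeDist_dic (E : Finset (V × V)) (w : V × V → I) (v : V) :
    ∃ Γ, IsLiveEdgeDist E (dic E w) v Γ := by
  refine ⟨(randomSubset w).map fun X => E ∩ X, fun L hL => ?_, fun S => ?_⟩
  · rw [PMF.mem_support_map_iff] at hL
    obtain ⟨X, _, rfl⟩ := hL
    exact Finset.inter_subset_left
  · rw [influence, dic, prob_map, prob_map]
    simp only [mem_eventual_dicState]

/-! #### Continuous-time independent cascade -/

section Cic

variable (E : Finset (V × V)) (d : V × V → ℝ≥0∞)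

lemma cicTime_succ_le (S : Finset V) (k : ℕ) (v : V) :
    cicTime E d S (k + 1) v ≤ cicTime E d S k v := min_le_left _ _

lemma cicTime_succ_le_add (S : Finset V) (k : ℕ) {u v : V} (h : (u, v) ∈ E) :
    cicTime E d S (k + 1) v ≤ cicTime E d S k u + d (u, v) :=
  (min_le_right _ _).trans ((iInf_le _ u).trans (by simp [h]))

lemma cicTime_succ_cases (S : Finset V) (k : ℕ) (v : V) :
    cicTime E d S (k + 1) v = cicTime E d S k v ∨ cicTime E d S (k + 1) v = ⊤ ∨
      ∃ u, (u, v) ∈ E ∧ cicTime E d S (k + 1) v = cicTime E d S k u + d (u, v) := by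
  have : Nonempty V := ⟨v⟩
  rcases min_choice (cicTime E d S k v)
    (⨅ u, if (u, v) ∈ E then cicTime E d S k u + d (u, v) else ⊤) with h | h
  · exact Or.inl h
  · obtain ⟨u, hu⟩ := exists_eq_ciInf_of_finite
      (f := fun u => if (u, v) ∈ E then cicTime E d S k u + d (u, v) else ⊤)
    have h' : cicTime E d S (k + 1) v =
        if (u, v) ∈ E then cicTime E d S k u + d (u, v) else ⊤ := h.trans hu.symm
    by_cases huv : (u, v) ∈ E
    · exact Or.inr (Or.inr ⟨u, huv, by rw [h', if_pos huv]⟩)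
    · exact Or.inr (Or.inl (by rw [h', if_neg huv]))

/-- If round `k + 1` of the Bellman iteration improves the value at `v`, then more than `k` nodes
have values at most that of `v`. -/
lemma exists_card_of_cicTime_lt (S : Finset V) (k : ℕ) :
    ∀ v, cicTime E d S (k + 1) v < cicTime E d S k v →
      ∃ U : Finset V, U.card = k + 1 ∧
        ∀ w ∈ U, cicTime E d S (k + 1) w ≤ cicTime E d S (k + 1) v := by
  induction k with
  | zero => exact fun v _ => ⟨{v}, by simp, by simp⟩
  | succ k ih =>
    intro v hv
    rcases cicTime_succ_cases E d S (k + 1) v with h | h | ⟨u, hu, h⟩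
    · exact absurd h hv.ne
    · exact absurd (h ▸ hv) not_top_lt
    -- An improvement at `v` through `u` must come from an improvement at `u` one round earlier;
    -- otherwise the edge would have been exploited already.
    · have hlt : cicTime E d S (k + 1) u < cicTime E d S k u := by
        refine lt_of_le_of_ne (cicTime_succ_le E d S k u) fun he => ?_
        refine absurd (cicTime_succ_le_add E d S k hu) (not_le.2 ?_)
        rwa [← he, ← h]
      obtain ⟨U, hU, hle⟩ := ih u hlt
      have hle' : ∀ w ∈ U, cicTime E d S (k + 1) w ≤ cicTime E d S (k + 2) v := fun w hw =>
        (hle w hw).trans (h ▸ le_self_add)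
      -- Nodes of `U` are, after round `k + 1`, at most the new value of `v`, whereas `v` itself was
      -- still strictly above it.
      have hvU : v ∉ U := fun hvU => absurd (hle' v hvU) (not_le.2 hv)
      refine ⟨insert v U, by rw [Finset.card_insert_of_notMem hvU, hU], fun w hw => ?_⟩
      rcases Finset.mem_insert.1 hw with rfl | hw
      · exact le_rfl
      · exact (cicTime_succ_le E d S (k + 1) w).trans (hle' w hw)

/-- The infimum is attained: an improvement after `Fintype.card V` rounds would produce more
distinct nodes than exist. Zero delays are harmless, since the count only uses weak inequalities
between values. -/
lemma iInf_cicTime_le_iff (S : Finset V) (v : V) (c : ℝ≥0∞) :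
    (⨅ k, cicTime E d S k v) ≤ c ↔ ∃ k, cicTime E d S k v ≤ c := by
  refine ⟨fun h => ⟨Fintype.card V, ?_⟩, fun ⟨k, hk⟩ => (iInf_le _ k).trans hk⟩
  have anti : Antitone fun k => cicTime E d S k v :=
    antitone_nat_of_succ_le fun k => cicTime_succ_le E d S k v
  have stable : ∀ j, cicTime E d S (Fintype.card V + j) v = cicTime E d S (Fintype.card V) v := by
    intro j
    induction j with
    | zero => rfl
    | succ j ih =>
      rw [← ih]
      refine le_antisymm (cicTime_succ_le E d S _ v) (not_lt.1 fun hlt => ?_)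
      obtain ⟨U, hU, _⟩ := exists_card_of_cicTime_lt E d S _ v hlt
      have h' : Fintype.card V + j + 1 ≤ Fintype.card V := hU ▸ U.card_le_univ
      omega
  refine le_trans (le_iInf fun k => ?_) h
  exact (stable k).symm.le.trans (anti (Nat.le_add_left _ _))

lemma cicTime_le_of_mem {S : Finset V} {u : V} (hu : u ∈ S) (k : ℕ) :
    ∀ v, cicTime E d S k v ≤ cicTime E d {u} k v := by
  induction k with
  | zero =>
    intro v
    by_cases hv : v = u
    · subst hv; simp [cicTime, hu]
    · simp [cicTime, hv]
  | succ k ih =>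
    intro v
    refine min_le_min (ih v) (iInf_mono fun x => ?_)
    split_ifs
    · exact add_le_add_left (ih x) _
    · exact le_rfl

/-- A finite value comes from a chain, which starts at a single seed. The value `⊤` must be excluded
because `S` may be empty. -/
lemma exists_cicTime_le (S : Finset V) (k : ℕ) :
    ∀ v, cicTime E d S k v ≠ ⊤ → ∃ u ∈ S, cicTime E d {u} k v ≤ cicTime E d S k v := by
  induction k with
  | zero =>
    intro v hv
    by_cases h : v ∈ S
    · exact ⟨v, h, by simp [cicTime]⟩
    · simp [cicTime, h] at hv
  | succ k ih =>
    intro v hv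
    rcases cicTime_succ_cases E d S k v with h | h | ⟨x, hx, h⟩
    · obtain ⟨u, hu, hle⟩ := ih v (h ▸ hv)
      exact ⟨u, hu, (cicTime_succ_le E d _ k v).trans (hle.trans h.ge)⟩
    · exact absurd h hv
    · obtain ⟨u, hu, hle⟩ := ih x fun h' => hv (by rw [h, h', top_add])
      exact ⟨u, hu, (cicTime_succ_le_add E d _ k hx).trans (h ▸ add_le_add_left hle _)⟩

/-- The recursion extends chains at their end. Measuring the remaining time to a fixed target
requires extending them at the beginning. -/
lemma cicTime_head_le {x w : V} (h : (x, w) ∈ E) (j : ℕ) :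
    ∀ y, cicTime E d {x} (j + 1) y ≤ d (x, w) + cicTime E d {w} j y := by
  induction j with
  | zero =>
    intro y
    by_cases hy : y = w
    · subst hy
      exact (cicTime_succ_le_add E d _ 0 h).trans (by simp [cicTime])
    · simp [cicTime, hy]
  | succ j ih =>
    intro y
    rcases cicTime_succ_cases E d {w} j y with h' | h' | ⟨u, hu, h'⟩
    · rw [h']
      exact (cicTime_succ_le E d _ _ y).trans (ih y)
    · simp [h']
    · rw [h', ← add_assoc]
      exact (cicTime_succ_le_add E d _ _ hu).trans (add_le_add_left (ih u) _)

/-- The edges both of whose ends reach `v` within time `τ`. -/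
noncomputable def cicLive (τ : ℝ≥0) (v : V) : Finset (V × V) :=
  E.filter fun e => v ∈ cicActive E d τ {e.1} ∧ v ∈ cicActive E d τ {e.2}

lemma mem_cicActive {τ : ℝ≥0} {S : Finset V} {v : V} :
    v ∈ cicActive E d τ S ↔ ∃ k, cicTime E d S k v ≤ τ := by
  simp only [cicActive, Finset.mem_filter, Finset.mem_univ, true_and]
  exact iInf_cicTime_le_iff E d S v τ

/-- The last edge of the first leg is moved to the second leg while the total stays within the
window. Each end of a moved edge is thus the start of a second leg of length at most `τ`, which
makes the edge live. -/
lemma reflTransGen_cicLive (τ : ℝ≥0) {u v : V} (k : ℕ) :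
    ∀ w j, cicTime E d {u} k w + cicTime E d {w} j v ≤ τ →
      Relation.ReflTransGen (fun a b => (a, b) ∈ cicLive E d τ v) u w := by
  induction k with
  | zero =>
    intro w j h
    by_cases hw : w = u
    · subst hw; exact .refl
    · simp [cicTime, hw] at h
  | succ k ih =>
    intro w j h
    rcases cicTime_succ_cases E d {u} k w with h' | h' | ⟨x, hx, h'⟩
    · exact ih w j (h' ▸ h)
    · simp [h'] at h
    · rw [h', add_assoc] at h
      have h1 := cicTime_head_le E d hx j v
      refine (ih x (j + 1) ((add_le_add_right h1 _).trans h)).tail ?_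
      simp only [cicLive, Finset.mem_filter, mem_cicActive]
      exact ⟨hx, ⟨j + 1, h1.trans (le_add_self.trans h)⟩,
        ⟨j, le_add_self.trans (le_add_self.trans h)⟩⟩

/-- In the converse direction no delays along the live path need to be added up: the definition of a
live edge already says that the start of the first edge reaches `v` in time. The empty path is the
case where `v` is a seed. -/
lemma mem_cicActive_iff_reach (τ : ℝ≥0) (S : Finset V) (v : V) :
    v ∈ cicActive E d τ S ↔ ∃ u ∈ S, u ∈ reachSet (cicLive E d τ v) v := by
  constructor
  · intro h
    obtain ⟨k, hk⟩ := (mem_cicActive E d).1 h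
    obtain ⟨u, hu, hle⟩ := exists_cicTime_le E d S k v (hk.trans_lt ENNReal.coe_lt_top).ne
    refine ⟨u, hu, mem_reachSet.2 (reflTransGen_cicLive E d τ k v 0 ?_)⟩
    simpa [cicTime] using hle.trans hk
  · rintro ⟨u, hu, h⟩
    rcases (mem_reachSet.1 h).cases_head with rfl | ⟨b, hb, _⟩
    · exact (mem_cicActive E d).2 ⟨0, by simp [cicTime, hu]⟩
    · obtain ⟨k, hk⟩ := (mem_cicActive E d).1 (Finset.mem_filter.1 hb).2.1
      exact (mem_cicActive E d).2 ⟨k, (cicTime_le_of_mem E d hu k v).trans hk⟩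

end Cic

lemma measurableSet_mem_cicActive (E : Finset (V × V)) (τ : ℝ≥0) (S : Finset V) (v : V) :
    MeasurableSet {d : V × V → ℝ≥0∞ | v ∈ cicActive E d τ S} := by
  simp only [cicActive, Finset.mem_filter, Finset.mem_univ, true_and]
  exact measurableSet_le (Measurable.iInf fun k => measurable_cicTime E S k v) measurable_const

lemma exists_isLiveEdgeDist_cic (E : Finset (V × V))
    (delay : V × V → ProbabilityMeasure ℝ≥0∞) (τ : ℝ≥0) (v : V) :
    ∃ Γ, IsLiveEdgeDist E (cic E delay τ) v Γ := by
  have hm : ∀ L, MeasurableSet {d : V × V → ℝ≥0∞ | cicLive E d τ v = L} := by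
    refine measurableSet_eq_of_mem fun e => ?_
    simp only [cicLive, Finset.mem_filter]
    exact (MeasurableSet.const _).inter ((measurableSet_mem_cicActive E τ _ v).inter
      (measurableSet_mem_cicActive E τ _ v))
  refine ⟨lawOf (Measure.pi fun e => (delay e : Measure ℝ≥0∞)) (fun d => cicLive E d τ v) hm,
    fun L hL => ?_, fun S => ?_⟩
  · rw [PMF.mem_support_iff] at hL
    obtain ⟨d, hd⟩ := nonempty_of_measure_ne_zero hL
    rw [← (show cicLive E d τ v = L from hd)]
    exact Finset.filter_subset _ _
  · rw [influence, cic, prob_lawOf, prob_lawOf]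
    simp only [mem_cicActive_iff_reach]

end LiveEdge

/-! #### Linear threshold -/

section Threshold

variable {V : Type*} [Fintype V] [DecidableEq V]

open Classical in
/-- The progressive process in which the inactive node `v` becomes active as soon as the set of
active nodes `A` satisfies `c v A (ω v)`. -/
noncomputable def progressive {Ω : Type*} (c : V → Finset V → Ω → Prop) (S : Finset V)
    (ω : V → Ω) : ℕ → Finset V
  | 0 => S
  | t + 1 => progressive c S ω t ∪ Finset.univ.filter fun v => c v (progressive c S ω t) (ω v)

/-! ### The constraint that a prescribed history puts on the randomness of one node -/

section SingleNode

variable {V : Type*}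

/-- The values of the randomness of the node `v` that are consistent with the history `a`. -/
def nodeEvent {Ω : Type*} (c : Finset V → Ω → Prop) (v : V) (a : ℕ → Finset V) (t : ℕ) : Set Ω :=
  {x | ∀ i < t, (v ∈ a (i + 1) ↔ v ∈ a i ∨ c (a i) x)}

lemma measurableSet_nodeEvent {Ω : Type*} [MeasurableSpace Ω] {c : Finset V → Ω → Prop}
    (hm : ∀ A, MeasurableSet {x | c A x}) (v : V) (a : ℕ → Finset V) (t : ℕ) :
    MeasurableSet (nodeEvent c v a t) := by
  have : nodeEvent c v a t = ⋂ i, ⋂ _ : i < t, {x | v ∈ a (i + 1) ↔ v ∈ a i ∨ c (a i) x} := by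
    ext x; simp [nodeEvent]
  rw [this]
  refine MeasurableSet.iInter fun i => MeasurableSet.iInter fun _ => ?_
  by_cases h : v ∈ a i
  · simp [h]
  · have h1 : MeasurableSet {x | ¬ c (a i) x} := (hm (a i)).compl
    by_cases h' : v ∈ a (i + 1)
    · simpa only [h, h', true_iff, false_or] using hm (a i)
    · simpa only [h, h', false_iff, false_or] using h1

lemma nodeEvent_succ {Ω : Type*} (c : Finset V → Ω → Prop) (v : V) (a : ℕ → Finset V) (t : ℕ) :
    nodeEvent c v a (t + 1) =
      nodeEvent c v a t ∩ {x | v ∈ a (t + 1) ↔ v ∈ a t ∨ c (a t) x} := by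
  ext x
  simp only [nodeEvent, Set.mem_ofPred_eq, Set.mem_inter_iff, Nat.lt_succ_iff_lt_or_eq]
  grind

/-- The history is increasing and the condition monotone, so failure at the last tested set `a (t -
1)` implies all earlier failures. At `t = 0` nothing has been tested. -/
lemma nodeEvent_of_notMem {Ω : Type*} {c : Finset V → Ω → Prop}
    (mono : ∀ A B, A ⊆ B → ∀ x, c A x → c B x) (v : V) (a : ℕ → Finset V) (t : ℕ)
    (ha : ∀ i < t, a i ⊆ a (i + 1)) (hv : v ∉ a t) :
    nodeEvent c v a t = if t = 0 then Set.univ else {x | c (a (t - 1)) x}ᶜ := by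
  have hle : ∀ j ≤ t, ∀ i ≤ j, a i ⊆ a j := fun j hj i hi =>
    Nat.decreasingInduction' (P := fun i => a i ⊆ a j)
      (fun k hk _ h => (ha k (hk.trans_le hj)).trans h) hi subset_rfl
  have hn : ∀ i ≤ t, v ∉ a i := fun i hi h => hv (hle t le_rfl i hi h)
  ext x
  have h1 : x ∈ nodeEvent c v a t ↔ ∀ i < t, ¬ c (a i) x := by
    refine forall₂_congr fun i hi => ?_
    simp [hn i hi.le, hn (i + 1) hi]
  rw [h1]
  rcases t with _ | s
  · simp
  · simp only [Nat.add_eq_zero_iff, one_ne_zero, and_false, if_false, Nat.add_sub_cancel,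
      Set.mem_compl_iff, Set.mem_ofPred_eq]
    exact ⟨fun h => h s s.lt_succ_self,
      fun h i hi hbi => h (mono _ _ (hle s s.le_succ i (Nat.lt_succ_iff.1 hi)) x hbi)⟩

/-- Activation exactly at step `t + 1` is a difference of two nested activation events, so its
probability depends only on theirs. -/
lemma nodeEvent_succ_of_notMem {Ω : Type*} {c : Finset V → Ω → Prop}
    (mono : ∀ A B, A ⊆ B → ∀ x, c A x → c B x) (v : V) (a : ℕ → Finset V) (t : ℕ)
    (ha : ∀ i < t, a i ⊆ a (i + 1)) (hv : v ∉ a t) (hv' : v ∈ a (t + 1)) :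
    nodeEvent c v a (t + 1) =
      if t = 0 then {x | c (a t) x} else {x | c (a t) x} \ {x | c (a (t - 1)) x} := by
  rw [nodeEvent_succ, nodeEvent_of_notMem mono v a t ha hv]
  ext x
  split_ifs <;> simp [hv, hv', and_comm]

/-- The probability that a node is consistent with a given history is determined by the
probabilities of its activation conditions. -/
lemma measure_nodeEvent_eq {Ω Ω' : Type*} [MeasurableSpace Ω] [MeasurableSpace Ω']
    {μ : Measure Ω} {μ' : Measure Ω'} [IsProbabilityMeasure μ] [IsProbabilityMeasure μ']
    {c : Finset V → Ω → Prop} {c' : Finset V → Ω' → Prop}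
    (hm : ∀ A, MeasurableSet {x | c A x}) (hm' : ∀ A, MeasurableSet {x | c' A x})
    (mono : ∀ A B, A ⊆ B → ∀ x, c A x → c B x) (mono' : ∀ A B, A ⊆ B → ∀ x, c' A x → c' B x)
    (heq : ∀ A, μ {x | c A x} = μ' {x | c' A x}) (v : V) (a : ℕ → Finset V) (t : ℕ)
    (ha : ∀ i < t, a i ⊆ a (i + 1)) :
    μ (nodeEvent c v a t) = μ' (nodeEvent c' v a t) := by
  induction t with
  | zero => simp [nodeEvent]
  | succ t ih =>
    by_cases hv : v ∈ a t
    · have hv' := ha t t.lt_succ_self hv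
      rw [nodeEvent_succ, nodeEvent_succ]
      simpa [hv, hv'] using ih fun i hi => ha i (hi.trans t.lt_succ_self)
    · have ha' : ∀ i < t, a i ⊆ a (i + 1) := fun i hi => ha i (hi.trans t.lt_succ_self)
      by_cases hv' : v ∈ a (t + 1)
      · rw [nodeEvent_succ_of_notMem mono v a t ha' hv hv',
          nodeEvent_succ_of_notMem mono' v a t ha' hv hv']
        split_ifs with ht
        · exact heq _
        · have hprev : a (t - 1) ⊆ a t := by
            have := ha (t - 1) (by omega)
            rwa [Nat.sub_add_cancel (Nat.one_le_iff_ne_zero.2 ht)] at this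
          have h : {x | c (a (t - 1)) x} ⊆ {x | c (a t) x} := mono _ _ hprev
          have h' : {x | c' (a (t - 1)) x} ⊆ {x | c' (a t) x} := mono' _ _ hprev
          rw [measure_sdiff h (hm _).nullMeasurableSet (measure_ne_top _ _),
            measure_sdiff h' (hm' _).nullMeasurableSet (measure_ne_top _ _), heq, heq]
      · rw [nodeEvent_of_notMem mono v a _ ha hv', nodeEvent_of_notMem mono' v a _ ha hv']
        simp only [Nat.add_eq_zero_iff, one_ne_zero, and_false, if_false, Nat.add_sub_cancel]
        rw [prob_compl_eq_one_sub (hm _), prob_compl_eq_one_sub (hm' _), heq]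

end SingleNode

/-! ### The law of the history of a progressive process -/

variable {Ω : Type*} {c : V → Finset V → Ω → Prop}

lemma subset_progressive_succ (S : Finset V) (ω : V → Ω) (t : ℕ) :
    progressive c S ω t ⊆ progressive c S ω (t + 1) :=
  Finset.subset_union_left

/-- Once the sets of the history are prescribed, each node is tested against fixed sets with its own
randomness alone. The event is therefore a box, and its product measure factors over the nodes. -/
lemma history_eq (S : Finset V) (a : ℕ → Finset V) (t : ℕ) (ha : a 0 = S) :
    {ω | ∀ i ≤ t, progressive c S ω i = a i} =
      Set.univ.pi fun v => nodeEvent (c v) v a t := by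
  ext ω
  simp only [Set.mem_ofPred_eq, Set.mem_pi, Set.mem_univ, true_imp_iff, nodeEvent]
  constructor
  · intro h v i hi
    rw [← h (i + 1) hi, ← h i hi.le]
    simp [progressive]
  · intro h i
    induction i with
    | zero => intro _; rw [ha]; rfl
    | succ i ih =>
      intro hi
      ext v
      rw [h v i hi, ← ih (Nat.le_of_succ_le hi)]
      simp [progressive]

lemma history_eq_empty (S : Finset V) (a : ℕ → Finset V) (t : ℕ)
    (h : ¬ (a 0 = S ∧ ∀ i < t, a i ⊆ a (i + 1))) :
    {ω : V → Ω | ∀ i ≤ t, progressive c S ω i = a i} = ∅ := by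
  ext ω
  simp only [Set.mem_ofPred_eq, Set.mem_empty_iff_false, iff_false]
  refine fun h' => h ⟨(h' 0 (Nat.zero_le t)).symm, fun i hi => ?_⟩
  rw [← h' i hi.le, ← h' (i + 1) hi]
  exact subset_progressive_succ S ω i

/-- The history given by finitely many sets. -/
def extendHistory (t : ℕ) (a : Fin (t + 1) → Finset V) (i : ℕ) : Finset V :=
  if h : i < t + 1 then a ⟨i, h⟩ else ∅

lemma setOf_mem_progressive (S : Finset V) (v : V) (t : ℕ) :
    {ω : V → Ω | v ∈ progressive c S ω t} =
      ⋃ a ∈ Finset.univ.filter (fun a : Fin (t + 1) → Finset V => v ∈ a (Fin.last t)),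
        {ω | ∀ i ≤ t, progressive c S ω i = extendHistory t a i} := by
  ext ω
  simp only [Set.mem_ofPred_eq, Finset.mem_filter, Finset.mem_univ, true_and, Set.mem_iUnion,
    exists_prop]
  constructor
  · intro h
    refine ⟨fun i => progressive c S ω i, by simpa using h, fun i hi => ?_⟩
    simp [extendHistory, hi]
  · rintro ⟨a, ha, h⟩
    have := h t le_rfl
    simp only [extendHistory, Nat.lt_succ_self, dif_pos] at this
    rw [this]
    exact ha

lemma pairwiseDisjoint_history (S : Finset V) (t : ℕ) (s : Set (Fin (t + 1) → Finset V)) :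
    s.PairwiseDisjoint fun a =>
      {ω : V → Ω | ∀ i ≤ t, progressive c S ω i = extendHistory t a i} := by
  intro a _ a' _ hne
  refine Set.disjoint_left.mpr fun ω h h' => hne (funext fun i => ?_)
  have h1 := (h i (Nat.lt_succ_iff.1 i.2)).symm.trans (h' i (Nat.lt_succ_iff.1 i.2))
  rwa [extendHistory, extendHistory, dif_pos i.2, dif_pos i.2] at h1

lemma monotone_setOf_mem_progressive (S : Finset V) (v : V) :
    Monotone fun t => {ω : V → Ω | v ∈ progressive c S ω t} :=
  monotone_nat_of_le_succ fun t ω h => subset_progressive_succ S ω t h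

lemma measurableSet_history [MeasurableSpace Ω] (hm : ∀ v A, MeasurableSet {x | c v A x})
    (S : Finset V) (a : ℕ → Finset V) (t : ℕ) :
    MeasurableSet {ω : V → Ω | ∀ i ≤ t, progressive c S ω i = a i} := by
  by_cases ha : a 0 = S
  · rw [history_eq S a t ha]
    exact MeasurableSet.univ_pi fun v => measurableSet_nodeEvent (hm v) v a t
  · convert MeasurableSet.empty
    ext ω
    simp only [Set.mem_ofPred_eq, Set.mem_empty_iff_false, iff_false]
    exact fun h => ha (h 0 (Nat.zero_le t)).symm

variable {Ω' : Type*} {c' : V → Finset V → Ω' → Prop} [MeasurableSpace Ω] [MeasurableSpace Ω']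
  {μ : V → Measure Ω} {μ' : V → Measure Ω'} [∀ v, IsProbabilityMeasure (μ v)]
  [∀ v, IsProbabilityMeasure (μ' v)]

lemma measure_history_eq
    (hm : ∀ v A, MeasurableSet {x | c v A x}) (hm' : ∀ v A, MeasurableSet {x | c' v A x})
    (mono : ∀ v A B, A ⊆ B → ∀ x, c v A x → c v B x)
    (mono' : ∀ v A B, A ⊆ B → ∀ x, c' v A x → c' v B x)
    (heq : ∀ v A, μ v {x | c v A x} = μ' v {x | c' v A x})
    (S : Finset V) (a : ℕ → Finset V) (t : ℕ) :
    Measure.pi μ {ω | ∀ i ≤ t, progressive c S ω i = a i} =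
      Measure.pi μ' {ω | ∀ i ≤ t, progressive c' S ω i = a i} := by
  by_cases h : a 0 = S ∧ ∀ i < t, a i ⊆ a (i + 1)
  · rw [history_eq S a t h.1, history_eq S a t h.1, Measure.pi_pi, Measure.pi_pi]
    exact Finset.prod_congr rfl fun v _ => measure_nodeEvent_eq (hm v) (hm' v) (mono v) (mono' v)
      (heq v) v a t h.2
  · rw [history_eq_empty S a t h, history_eq_empty S a t h, measure_empty, measure_empty]

/-- Two progressive processes with the same marginal activation probabilities reach every node
with the same probability. -/
lemma measure_progressive_eq
    (hm : ∀ v A, MeasurableSet {x | c v A x}) (hm' : ∀ v A, MeasurableSet {x | c' v A x})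
    (mono : ∀ v A B, A ⊆ B → ∀ x, c v A x → c v B x)
    (mono' : ∀ v A B, A ⊆ B → ∀ x, c' v A x → c' v B x)
    (heq : ∀ v A, μ v {x | c v A x} = μ' v {x | c' v A x}) (S : Finset V) (v : V) :
    Measure.pi μ {ω | ∃ t, v ∈ progressive c S ω t} =
      Measure.pi μ' {ω | ∃ t, v ∈ progressive c' S ω t} := by
  -- At a fixed time, activity of `v` is a finite disjoint union of histories; the limit in `t` is
  -- continuity from below.
  have step : ∀ t, Measure.pi μ {ω | v ∈ progressive c S ω t} =
      Measure.pi μ' {ω | v ∈ progressive c' S ω t} := by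
    intro t
    rw [setOf_mem_progressive, setOf_mem_progressive,
      measure_biUnion_finset (pairwiseDisjoint_history S t _)
        fun a _ => measurableSet_history hm S _ t,
      measure_biUnion_finset (pairwiseDisjoint_history S t _)
        fun a _ => measurableSet_history hm' S _ t]
    exact Finset.sum_congr rfl fun a _ => measure_history_eq hm hm' mono mono' heq S _ t
  rw [Set.ofPred_exists, Set.ofPred_exists, (monotone_setOf_mem_progressive S v).measure_iUnion,
    (monotone_setOf_mem_progressive S v).measure_iUnion]
  exact iSup_congr step

end Threshold

/-! ### Linear thresholds as random choices of in-neighbours -/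

section Dlt

variable {V : Type*} [Fintype V] [DecidableEq V]

lemma dltActive_eq_progressive (E : Finset (V × V)) (w : V × V → ℝ) (θ : V → I) (S : Finset V)
    (t : ℕ) : dltActive E w θ S t = progressive
      (fun v A (x : I) => (x : ℝ) ≤ ∑ u ∈ A.filter (fun u => (u, v) ∈ E), w (u, v)) S θ t := by
  induction t with
  | zero => rfl
  | succ t ih => simp only [dltActive, progressive, ih]

/-- The live-edge graph in which every node keeps the edge from the in-neighbour it chose. -/
def choiceGraph (E : Finset (V × V)) (x : V → Option V) : Finset (V × V) :=
  E.filter fun e => x e.2 = some e.1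

lemma exists_mem_progressive_choice (E : Finset (V × V)) (x : V → Option V) (S : Finset V)
    (v : V) :
    (∃ t, v ∈ progressive (fun v A (y : Option V) => ∃ u ∈ A, (u, v) ∈ E ∧ y = some u) S x t) ↔
      ∃ u ∈ S, u ∈ reachSet (choiceGraph E x) v := by
  simp only [mem_reachSet]
  constructor
  · rintro ⟨t, ht⟩
    induction t generalizing v with
    | zero => exact ⟨v, ht, .refl⟩
    | succ t ih =>
      simp only [progressive, Finset.mem_union, Finset.mem_filter, Finset.mem_univ,
        true_and] at ht
      rcases ht with ht | ⟨y, hy, hE, hx⟩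
      · exact ih v ht
      · obtain ⟨u, hu, huy⟩ := ih y hy
        exact ⟨u, hu, huy.tail (by simp [choiceGraph, hE, hx])⟩
  · rintro ⟨u, hu, huv⟩
    induction huv with
    | refl => exact ⟨0, hu⟩
    | @tail y z _ hyz ih =>
      obtain ⟨t, ht⟩ := ih
      obtain ⟨hE, hx⟩ := Finset.mem_filter.1 hyz
      refine ⟨t + 1, Finset.mem_union_right _ ?_⟩
      simpa using ⟨y, ht, hE, hx⟩

/-- The law of the in-neighbour chosen by `v`: every in-neighbour `u` with probability
`w (u, v)`, and none with the remaining probability. -/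
noncomputable def choiceLaw (E : Finset (V × V)) (w : V × V → ℝ) (hw : ∀ e ∈ E, 0 ≤ w e) (v : V)
    (hv : ∑ u ∈ Finset.univ.filter (fun u => (u, v) ∈ E), w (u, v) ≤ 1) : PMF (Option V) :=
  PMF.ofFintype (fun o => o.elim
    (ENNReal.ofReal (1 - ∑ u ∈ Finset.univ.filter (fun u => (u, v) ∈ E), w (u, v)))
    fun u => if (u, v) ∈ E then ENNReal.ofReal (w (u, v)) else 0) (by
  rw [Fintype.sum_option]
  simp only [Option.elim]
  rw [← Finset.sum_filter, ← ENNReal.ofReal_sum_of_nonneg, ← ENNReal.ofReal_add (sub_nonneg.2 hv)]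
  · simp
  · exact Finset.sum_nonneg fun u hu => hw _ (Finset.mem_filter.1 hu).2
  · exact fun u hu => hw _ (Finset.mem_filter.1 hu).2)

/-- Threshold and choice rules are both monotone, and each is satisfied by the active set `A` with
probability equal to the total weight from `A` into the node. Hence `measure_progressive_eq`
applies, and the choice process is reachability in the graph of chosen edges. -/
lemma exists_isLiveEdgeDist_dlt (E : Finset (V × V)) (w : V × V → ℝ) (hw : ∀ e ∈ E, 0 ≤ w e)
    (hsum : ∀ v, ∑ u ∈ Finset.univ.filter (fun u => (u, v) ∈ E), w (u, v) ≤ 1) (v : V) :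
    ∃ Γ, IsLiveEdgeDist E (dlt E w) v Γ := by
  let _ : MeasurableSpace (Option V) := ⊤
  have hdisc : DiscreteMeasurableSpace (Option V) := ⟨fun _ => trivial⟩
  let μ' (v : V) : Measure (Option V) := (choiceLaw E w hw v (hsum v)).toMeasure
  have hm : ∀ L, MeasurableSet {x : V → Option V | choiceGraph E x = L} := by
    refine measurableSet_eq_of_mem fun e => ?_
    simp only [choiceGraph, Finset.mem_filter]
    have h : MeasurableSet {x : V → Option V | x e.2 = some e.1} :=
      (measurable_pi_apply e.2 : Measurable fun x : V → Option V => x e.2)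
        (MeasurableSet.of_discrete : MeasurableSet ({some e.1} : Set (Option V)))
    exact (MeasurableSet.const _).inter h
  have nonneg : ∀ v (A : Finset V), ∀ u ∈ A.filter (fun u => (u, v) ∈ E), 0 ≤ w (u, v) :=
    fun v A u hu => hw _ (Finset.mem_filter.1 hu).2
  have le_one : ∀ v (A : Finset V), ∑ u ∈ A.filter (fun u => (u, v) ∈ E), w (u, v) ≤ 1 :=
    fun v A => le_trans (Finset.sum_le_sum_of_subset_of_nonneg
      (Finset.filter_subset_filter _ A.subset_univ) fun u hu _ => nonneg v _ u hu) (hsum v)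
  refine ⟨lawOf (Measure.pi μ') (choiceGraph E) hm, fun L hL => ?_, fun S => ?_⟩
  · rw [PMF.mem_support_iff] at hL
    obtain ⟨x, hx⟩ := nonempty_of_measure_ne_zero hL
    rw [← (show choiceGraph E x = L from hx)]
    exact Finset.filter_subset _ _
  · rw [influence, dlt, prob_lawOf, prob_lawOf]
    simp only [← exists_mem_progressive_choice, eventual, dltActive_eq_progressive,
      Finset.mem_filter, Finset.mem_univ, true_and]
    congr 1
    refine measure_progressive_eq ?_ ?_ ?_ ?_ ?_ S v
    · exact fun v A => measurableSet_le measurable_subtype_coe measurable_const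
    · exact fun v A => MeasurableSet.of_discrete
    · exact fun v A B hAB x hx => hx.trans (Finset.sum_le_sum_of_subset_of_nonneg
        (Finset.filter_subset_filter _ hAB) fun u hu _ => nonneg v _ u hu)
    · exact fun v A B hAB x ⟨u, hu, h⟩ => ⟨u, hAB hu, h⟩
    · intro v A
      have h1 : ∀ s : I, {x : I | (x : ℝ) ≤ s} = Set.Iic s := fun s => rfl
      rw [h1 ⟨_, Finset.sum_nonneg (nonneg v A), le_one v A⟩, unitInterval.volume_Iic]
      have h2 : {y : Option V | ∃ u ∈ A, (u, v) ∈ E ∧ y = some u} =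
          ((A.filter fun u => (u, v) ∈ E).image some : Finset (Option V)) := by
        ext y
        simp only [Set.mem_ofPred_eq, Finset.coe_image, Set.mem_image, Finset.mem_coe,
          Finset.mem_filter]
        grind
      rw [h2, PMF.toMeasure_apply_finset, Finset.sum_image (by simp),
        ENNReal.ofReal_sum_of_nonneg (nonneg v A)]
      refine Finset.sum_congr rfl fun u hu => ?_
      simp [choiceLaw, (Finset.mem_filter.1 hu).2]

/-- Every diffusion model has a live-edge description. -/
theorem exists_isLiveEdgeDist (E : Finset (V × V)) (m : Model)
    {D : Finset V → PMF (Finset V)} (hD : D ∈ m.instances E) (v : V) :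
    ∃ Γ, IsLiveEdgeDist E D v Γ := by
  cases m with
  | DIC =>
    obtain ⟨w, rfl⟩ := hD
    exact exists_isLiveEdgeDist_dic E w v
  | DLT =>
    obtain ⟨w, hw, hsum, rfl⟩ := hD
    exact exists_isLiveEdgeDist_dlt E w hw hsum v
  | CIC =>
    obtain ⟨delay, τ, rfl⟩ := hD
    exact exists_isLiveEdgeDist_cic E delay τ v

end Dlt

/-! ### The logarithmic loss -/

/-- The log-likelihood of the parameter `t` for a (possibly fractional) label `u`. -/
noncomputable def logLik (u t : ℝ) : ℝ := u * Real.log t + (1 - u) * Real.log (1 - t)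

lemma corrLogLik_eq_logLik (r t y : ℝ) : corrLogLik r t y = logLik (y / r) t := rfl

/-- This is `log x ≤ x - 1` at `x = √f / √p`. Added over the two outcomes of a Bernoulli law, it
bounds the squared Hellinger distance by the relative entropy. -/
lemma two_mul_sub_sqrt_le {p f : ℝ} (hp : 0 ≤ p) (hf : 0 < f) :
    2 * (p - √p * √f) ≤ p * Real.log p - p * Real.log f := by
  rcases hp.eq_or_lt with rfl | hp
  · simp
  have hsp := Real.sqrt_pos.2 hp
  have hsf := Real.sqrt_pos.2 hf
  have h := Real.log_le_sub_one_of_pos (div_pos hsf hsp)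
  rw [Real.log_div hsf.ne' hsp.ne', Real.log_sqrt hf.le, Real.log_sqrt hp.le] at h
  have h2 : p * (√f / √p) = √p * √f := by
    field_simp
    rw [Real.sq_sqrt hp.le]
  nlinarith [mul_le_mul_of_nonneg_left h hp.le]

lemma sq_sub_le_four_mul {p f : ℝ} (hp : 0 ≤ p) (hp' : p ≤ 1) (hf : 0 ≤ f) (hf' : f ≤ 1) :
    (p - f) ^ 2 ≤ 4 * (√p - √f) ^ 2 := by
  have h1 : p - f = (√p - √f) * (√p + √f) := by
    nlinarith [Real.sq_sqrt hp, Real.sq_sqrt hf]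
  have h2 : √p ≤ 1 := Real.sqrt_le_one.2 hp'
  have h3 : √f ≤ 1 := Real.sqrt_le_one.2 hf'
  have h4 : (√p + √f) ^ 2 ≤ 4 := by nlinarith [Real.sqrt_nonneg p, Real.sqrt_nonneg f]
  rw [h1, mul_pow, mul_comm]
  exact mul_le_mul_of_nonneg_right h4 (sq_nonneg _)

/-- A form of Pinsker's inequality for Bernoulli laws. -/
lemma sq_sub_le_logLik {p f : ℝ} (hp : 0 ≤ p) (hp' : p ≤ 1) (hf : 0 < f) (hf' : f < 1) :
    (p - f) ^ 2 ≤ 2 * (logLik p p - logLik p f) := by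
  have h1 := two_mul_sub_sqrt_le hp hf
  have h2 := two_mul_sub_sqrt_le (sub_nonneg.2 hp') (sub_pos.2 hf')
  have h3 := sq_sub_le_four_mul hp hp' hf.le hf'.le
  have h4 := sq_sub_le_four_mul (p := 1 - p) (f := 1 - f) (by linarith) (by linarith)
    (by linarith) (by linarith)
  have e1 := Real.sq_sqrt hp
  have e2 := Real.sq_sqrt hf.le
  have e3 := Real.sq_sqrt (sub_nonneg.2 hp')
  have e4 := Real.sq_sqrt (sub_nonneg.2 hf'.le)
  have h5 : (1 - p - (1 - f)) ^ 2 = (p - f) ^ 2 := by ring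
  rw [h5] at h4
  simp only [logLik]
  nlinarith

lemma mul_log_sub_le {p f : ℝ} (hp : 0 ≤ p) (hf : 0 < f) :
    p * Real.log p - p * Real.log f ≤ p ^ 2 / f - p := by
  rcases hp.eq_or_lt with rfl | hp
  · simp
  have h := Real.log_le_sub_one_of_pos (div_pos hp hf)
  rw [Real.log_div hp.ne' hf.ne'] at h
  have := mul_le_mul_of_nonneg_left h hp.le
  calc p * Real.log p - p * Real.log f = p * (Real.log p - Real.log f) := by ring
    _ ≤ p * (p / f - 1) := this
    _ = p ^ 2 / f - p := by ring

/-- Relative entropy is at most chi-square. This is the converse direction to Pinsker, used for the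
approximating combination; truncation keeps the denominator away from zero. -/
lemma logLik_sub_le {p f : ℝ} (hp : 0 ≤ p) (hp' : p ≤ 1) (hf : 0 < f) (hf' : f < 1) :
    logLik p p - logLik p f ≤ (p - f) ^ 2 / (f * (1 - f)) := by
  have h1 := mul_log_sub_le hp hf
  have h2 := mul_log_sub_le (sub_nonneg.2 hp') (sub_pos.2 hf')
  have hf1 : (1 - f) ≠ 0 := (sub_pos.2 hf').ne'
  have h3 : p ^ 2 / f - p + ((1 - p) ^ 2 / (1 - f) - (1 - p)) = (p - f) ^ 2 / (f * (1 - f)) := by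
    field_simp
    ring
  rw [← h3]
  simp only [logLik]
  linarith

lemma le_mul_one_sub {lam f : ℝ} (h0 : 0 < lam) (h1 : lam ≤ 1 / 2) (hf : lam ≤ f)
    (hf' : f ≤ 1 - lam) : lam / 2 ≤ f * (1 - f) := by
  nlinarith [mul_nonneg (sub_nonneg.2 hf) (sub_nonneg.2 hf')]

lemma logLik_sub_le_of_abs_le {lam p f c : ℝ} (h0 : 0 < lam) (h1 : lam ≤ 1 / 2) (hp : 0 ≤ p)
    (hp' : p ≤ 1) (hf : lam ≤ f) (hf' : f ≤ 1 - lam) (hc : |p - f| ≤ c) :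
    logLik p p - logLik p f ≤ 2 * c ^ 2 / lam := by
  refine (logLik_sub_le hp hp' (h0.trans_le hf) (by linarith)).trans ?_
  have h2 := le_mul_one_sub h0 h1 hf hf'
  have h3 : (p - f) ^ 2 ≤ c ^ 2 := sq_le_sq' (by linarith [neg_le_of_abs_le hc]) (le_of_abs_le hc)
  rw [show 2 * c ^ 2 / lam = c ^ 2 / (lam / 2) by field_simp]
  exact div_le_div₀ (sq_nonneg _) h3 (by positivity) h2

/-- Moving towards the upper end of the truncation interval increases the noise-corrected
log-likelihood of a label that is never lost at least as much as its log-likelihood. -/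
lemma logLik_one_sub_le {lam f s : ℝ} (h0 : 0 < lam) (hf : 0 < f) (hf' : f ≤ 1 - lam)
    (hs : 1 ≤ s) :
    logLik 1 (1 - lam) - logLik 1 f ≤ logLik s (1 - lam) - logLik s f := by
  have h1 : Real.log f ≤ Real.log (1 - lam) := Real.log_le_log hf hf'
  have h2 : Real.log (1 - (1 - lam)) ≤ Real.log (1 - f) :=
    Real.log_le_log (by linarith) (by linarith)
  simp only [logLik]
  nlinarith [mul_nonneg (sub_nonneg.2 hs) (sub_nonneg.2 h1),
    mul_nonneg (sub_nonneg.2 hs) (sub_nonneg.2 h2)]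

lemma abs_logLik_le {lam u t s : ℝ} (h0 : 0 < lam) (ht : lam ≤ t) (ht' : t ≤ 1 - lam)
    (hu : 0 ≤ u) (hus : u ≤ s) (hs : 1 ≤ s) : |logLik u t| ≤ 2 * s * Real.log (1 / lam) := by
  have key : ∀ x, lam ≤ x → x ≤ 1 - lam → |Real.log x| ≤ Real.log (1 / lam) := by
    intro x hx hx'
    rw [abs_of_nonpos (Real.log_nonpos (h0.le.trans hx) (by linarith)), one_div, Real.log_inv,
      neg_le_neg_iff]
    exact Real.log_le_log h0 hx
  have hl : 0 ≤ Real.log (1 / lam) := (abs_nonneg _).trans (key t ht ht')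
  calc |logLik u t| ≤ |u * Real.log t| + |(1 - u) * Real.log (1 - t)| := abs_add_le _ _
    _ = |u| * |Real.log t| + |1 - u| * |Real.log (1 - t)| := by rw [abs_mul, abs_mul]
    _ ≤ s * Real.log (1 / lam) + s * Real.log (1 / lam) := by
      refine add_le_add (mul_le_mul ?_ (key t ht ht') (abs_nonneg _) (by linarith))
        (mul_le_mul ?_ (key _ (by linarith) (by linarith)) (abs_nonneg _) (by linarith))
      · rwa [abs_of_nonneg hu]
      · exact abs_le.2 ⟨by linarith, by linarith⟩
    _ = 2 * s * Real.log (1 / lam) := by ring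

/-! ### Sparsification of convex combinations -/

section Sparse

variable {α : Type*} [Fintype α] (p : PMF α)

lemma expect_log_le {X : α → ℝ} (hX : ∀ x, 0 < X x) (h0 : 0 < expect p X) :
    expect p (fun x => Real.log (X x)) ≤ Real.log (expect p X) := by
  have h : ∀ x, Real.log (X x) ≤
      Real.log (expect p X) + ((expect p X)⁻¹ * X x - 1) := by
    intro x
    have := Real.log_le_sub_one_of_pos (div_pos (hX x) h0)
    rw [Real.log_div (hX x).ne' h0.ne'] at this
    rw [inv_mul_eq_div]
    linarith
  refine (expect_mono p h).trans (le_of_eq ?_)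
  rw [expect_add, expect_sub, expect_const_mul, expect_const, expect_const,
    inv_mul_cancel₀ h0.ne']
  ring

/-- A reverse Jensen inequality. From `log (x / f) ≥ 1 - f / x`, the loss against the tangent line
at `f` is at most `(x - f) ^ 2 / (f * lam)`. A variance proportional to the mean `f` cancels the
`f`, leaving only one factor `1 / lam`. -/
lemma le_expect_log {X : α → ℝ} {lam c : ℝ} (h0 : 0 < lam) (hX : ∀ x, lam ≤ X x)
    (hvar : expect p (fun x => (X x - expect p X) ^ 2) ≤ c * expect p X) :
    Real.log (expect p X) - c / lam ≤ expect p (fun x => Real.log (X x)) := by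
  set f := expect p X with hf
  have hf0 : 0 < f := h0.trans_le (le_expect p hX)
  have h : ∀ x, Real.log f + (f⁻¹ * X x - 1) - (f * lam)⁻¹ * (X x - f) ^ 2 ≤
      Real.log (X x) := by
    intro x
    have hx := h0.trans_le (hX x)
    have h1 := Real.log_le_sub_one_of_pos (div_pos hf0 hx)
    rw [Real.log_div hf0.ne' hx.ne'] at h1
    have h2 : f⁻¹ * X x - 1 - (1 - f / X x) = (f * X x)⁻¹ * (X x - f) ^ 2 := by
      field_simp
    have h3 : (f * X x)⁻¹ * (X x - f) ^ 2 ≤ (f * lam)⁻¹ * (X x - f) ^ 2 :=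
      mul_le_mul_of_nonneg_right (inv_anti₀ (by positivity)
        (mul_le_mul_of_nonneg_left (hX x) hf0.le)) (sq_nonneg _)
    linarith
  refine le_trans (le_of_eq_of_le ?_ (sub_le_sub_left (mul_le_mul_of_nonneg_left hvar
    (by positivity : (0 : ℝ) ≤ (f * lam)⁻¹)) (Real.log f))) (le_of_eq_of_le ?_ (expect_mono p h))
  · field_simp
  · rw [expect_sub, expect_add, expect_sub, expect_const_mul, expect_const_mul, expect_const,
      expect_const, ← hf, inv_mul_cancel₀ hf0.ne']
    ring

/-- The truncated average of `φ` over a sample of size `m`. -/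
noncomputable def truncAvg (lam : ℝ) (φ : α → ℝ) {m : ℕ} (κ : Fin m → α) : ℝ :=
  (1 - 2 * lam) * ((m : ℝ)⁻¹ * ∑ j, φ (κ j)) + lam

lemma le_truncAvg {lam : ℝ} (h1 : lam ≤ 1 / 2) {φ : α → ℝ} (hφ : ∀ a, 0 ≤ φ a) {m : ℕ}
    (κ : Fin m → α) : lam ≤ truncAvg lam φ κ := by
  have h2 : 0 ≤ (m : ℝ)⁻¹ * ∑ j, φ (κ j) :=
    mul_nonneg (by positivity) (Finset.sum_nonneg fun j _ => hφ _)
  rw [truncAvg]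
  nlinarith

lemma one_sub_truncAvg (lam : ℝ) (φ : α → ℝ) {m : ℕ} (hm : 0 < m) (κ : Fin m → α) :
    1 - truncAvg lam φ κ = truncAvg lam (fun a => 1 - φ a) κ := by
  have : (m : ℝ) ≠ 0 := by positivity
  simp only [truncAvg, Finset.sum_sub_distrib, Finset.sum_const, Finset.card_univ,
    Fintype.card_fin, nsmul_eq_mul]
  field_simp
  ring

lemma expect_truncAvg (lam : ℝ) (φ : α → ℝ) {m : ℕ} (hm : 0 < m) :
    expect (productPMF fun _ : Fin m => p) (truncAvg lam φ) =
      (1 - 2 * lam) * expect p φ + lam := by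
  have : (m : ℝ) ≠ 0 := by positivity
  have h : ∀ j : Fin m, expect (productPMF fun _ : Fin m => p) (fun κ => φ (κ j)) = expect p φ :=
    fun j => expect_productPMF_eval (fun _ => p) j φ
  have h' : truncAvg lam φ =
      fun κ : Fin m → α => (1 - 2 * lam) * ((m : ℝ)⁻¹ * ∑ j, φ (κ j)) + lam := rfl
  simp only [h', expect_add, expect_const_mul, expect_sum, expect_const, h, Finset.sum_const,
    Finset.card_univ, Fintype.card_fin, nsmul_eq_mul]
  field_simp

/-- A variable with values in `[0, 1]` has variance at most its mean, and this survives averaging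
and truncation. It supplies the proportionality that `le_expect_log` needs. -/
lemma expect_truncAvg_sub_sq_le {lam : ℝ} (h0 : 0 < lam) (h1 : lam ≤ 1 / 2) {φ : α → ℝ}
    (hφ : ∀ a, 0 ≤ φ a) (hφ' : ∀ a, φ a ≤ 1) {m : ℕ} (hm : 0 < m) :
    expect (productPMF fun _ : Fin m => p)
        (fun κ => (truncAvg lam φ κ - ((1 - 2 * lam) * expect p φ + lam)) ^ 2) ≤
      (m : ℝ)⁻¹ * ((1 - 2 * lam) * expect p φ + lam) := by
  have hm0 : (m : ℝ) ≠ 0 := by positivity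
  set e := expect p φ with he
  have h2 : ∀ κ : Fin m → α, (truncAvg lam φ κ - ((1 - 2 * lam) * e + lam)) ^ 2 =
      ((1 - 2 * lam) * (m : ℝ)⁻¹) ^ 2 * (∑ j, (φ (κ j) - e)) ^ 2 := by
    intro κ
    simp only [truncAvg, Finset.sum_sub_distrib, Finset.sum_const, Finset.card_univ,
      Fintype.card_fin, nsmul_eq_mul]
    field_simp
    ring
  have h3 : expect p (fun a => φ a - e) = 0 := by rw [expect_sub, expect_const, sub_self]
  have h4 : expect p (fun a => (φ a - e) ^ 2) ≤ e := by
    have h5 : ∀ a, (φ a - e) ^ 2 ≤ (1 - 2 * e) * φ a + e ^ 2 := by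
      intro a
      nlinarith [mul_nonneg (hφ a) (sub_nonneg.2 (hφ' a))]
    refine (expect_mono p h5).trans ?_
    rw [expect_add, expect_const_mul, expect_const, ← he]
    nlinarith [sq_nonneg e]
  have e0 : 0 ≤ e := expect_nonneg p hφ
  simp only [h2]
  rw [expect_const_mul, expect_productPMF_sum_sq p m _ h3]
  calc ((1 - 2 * lam) * (m : ℝ)⁻¹) ^ 2 * (m * expect p fun a => (φ a - e) ^ 2)
      = (m : ℝ)⁻¹ * ((1 - 2 * lam) ^ 2 * expect p fun a => (φ a - e) ^ 2) := by
        field_simp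
    _ ≤ (m : ℝ)⁻¹ * ((1 - 2 * lam) ^ 2 * e) := by gcongr
    _ ≤ (m : ℝ)⁻¹ * ((1 - 2 * lam) * e + lam) := by
        refine mul_le_mul_of_nonneg_left ?_ (by positivity)
        nlinarith [mul_nonneg (mul_nonneg (by linarith : (0 : ℝ) ≤ 1 - 2 * lam) h0.le) e0]

variable {lam : ℝ} {φ : α → ℝ} {m : ℕ}

lemma expect_log_truncAvg (h0 : 0 < lam) (h1 : lam ≤ 1 / 2) (hφ : ∀ a, 0 ≤ φ a)
    (hφ' : ∀ a, φ a ≤ 1) (hm : 0 < m) :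
    expect (productPMF fun _ : Fin m => p) (fun κ => Real.log (truncAvg lam φ κ)) ≤
        Real.log ((1 - 2 * lam) * expect p φ + lam) ∧
      Real.log ((1 - 2 * lam) * expect p φ + lam) - (m : ℝ)⁻¹ / lam ≤
        expect (productPMF fun _ : Fin m => p) (fun κ => Real.log (truncAvg lam φ κ)) := by
  have hl := fun κ : Fin m → α => le_truncAvg h1 hφ κ
  rw [← expect_truncAvg p lam φ hm]
  refine ⟨expect_log_le _ (fun κ => h0.trans_le (hl κ)) (h0.trans_le (le_expect _ hl)),
    le_expect_log _ h0 hl ?_⟩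
  rw [expect_truncAvg p lam φ hm]
  exact expect_truncAvg_sub_sq_le p h0 h1 hφ hφ' hm

lemma expect_log_one_sub_truncAvg (h0 : 0 < lam) (h1 : lam ≤ 1 / 2) (hφ : ∀ a, 0 ≤ φ a)
    (hφ' : ∀ a, φ a ≤ 1) (hm : 0 < m) :
    expect (productPMF fun _ : Fin m => p) (fun κ => Real.log (1 - truncAvg lam φ κ)) ≤
        Real.log (1 - ((1 - 2 * lam) * expect p φ + lam)) ∧
      Real.log (1 - ((1 - 2 * lam) * expect p φ + lam)) - (m : ℝ)⁻¹ / lam ≤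
        expect (productPMF fun _ : Fin m => p) (fun κ => Real.log (1 - truncAvg lam φ κ)) := by
  have h := expect_log_truncAvg p h0 h1 (φ := fun a => 1 - φ a)
    (fun a => sub_nonneg.2 (hφ' a)) (fun a => by linarith [hφ a]) hm
  rw [expect_sub, expect_const, show (1 - 2 * lam) * (1 - expect p φ) + lam =
    1 - ((1 - 2 * lam) * expect p φ + lam) by ring] at h
  simpa only [one_sub_truncAvg lam φ hm] using h

lemma expect_logLik_truncAvg_le (h0 : 0 < lam) (h1 : lam ≤ 1 / 2) (hφ : ∀ a, 0 ≤ φ a)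
    (hφ' : ∀ a, φ a ≤ 1) (hm : 0 < m) {u : ℝ} (hu : 0 ≤ u) (hu' : u ≤ 1) :
    expect (productPMF fun _ : Fin m => p) (fun κ => logLik u (truncAvg lam φ κ)) ≤
      logLik u ((1 - 2 * lam) * expect p φ + lam) := by
  simp only [logLik]
  rw [expect_add, expect_const_mul, expect_const_mul]
  exact add_le_add
    (mul_le_mul_of_nonneg_left (expect_log_truncAvg p h0 h1 hφ hφ' hm).1 hu)
    (mul_le_mul_of_nonneg_left (expect_log_one_sub_truncAvg p h0 h1 hφ hφ' hm).1
      (sub_nonneg.2 hu'))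

/-- Corrected labels may exceed 1. Then the coefficient `1 - u` is negative, and the second
logarithm is controlled by Jensen's inequality instead of its reverse. -/
lemma logLik_le_expect_truncAvg (h0 : 0 < lam) (h1 : lam ≤ 1 / 2) (hφ : ∀ a, 0 ≤ φ a)
    (hφ' : ∀ a, φ a ≤ 1) (hm : 0 < m) {u : ℝ} (hu : 0 ≤ u) :
    logLik u ((1 - 2 * lam) * expect p φ + lam) ≤
      expect (productPMF fun _ : Fin m => p) (fun κ => logLik u (truncAvg lam φ κ)) +
        (m : ℝ)⁻¹ / lam * (1 + u) := by
  simp only [logLik]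
  rw [expect_add, expect_const_mul, expect_const_mul]
  obtain ⟨_, h2⟩ := expect_log_truncAvg p h0 h1 hφ hφ' hm
  obtain ⟨h3, h4⟩ := expect_log_one_sub_truncAvg p h0 h1 hφ hφ' hm
  have hc : 0 ≤ (m : ℝ)⁻¹ / lam := by positivity
  have h5 := mul_le_mul_of_nonneg_left h2 hu
  rcases le_total u 1 with hu' | hu'
  · have h6 := mul_le_mul_of_nonneg_left h4 (sub_nonneg.2 hu')
    nlinarith [mul_nonneg hc hu]
  · have h6 := mul_le_mul_of_nonneg_left h3 (sub_nonneg.2 hu')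
    nlinarith [mul_nonneg hc hu]

end Sparse

/-! ### Empirical and expected log-likelihood -/

section Sample

variable {V : Type*} [Fintype V] [DecidableEq V]

/-- The indicator that `S` meets `T`, in the form in which it occurs in `reachFun`. -/
noncomputable def hit (T S : Finset V) : ℝ := min (charVec S ⬝ᵥ charVec T) 1

lemma hit_eq (T S : Finset V) : hit T S = if ∃ u ∈ S, u ∈ T then 1 else 0 := by
  have nonneg : ∀ u, 0 ≤ charVec S u * charVec T u := fun u => by
    simp only [charVec]
    split_ifs <;> norm_num
  rw [hit, dotProduct]
  split_ifs with h
  · obtain ⟨u, hS, hT⟩ := h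
    refine min_eq_right ?_
    calc (1 : ℝ) = charVec S u * charVec T u := by simp [charVec, hS, hT]
      _ ≤ _ := Finset.single_le_sum (fun w _ => nonneg w) (Finset.mem_univ u)
  · rw [Finset.sum_eq_zero]
    · simp
    · intro u _
      by_cases hS : u ∈ S
      · have hT : u ∉ T := fun hT => h ⟨u, hS, hT⟩
        simp [charVec, hT]
      · simp [charVec, hS]

lemma hit_nonneg (T S : Finset V) : 0 ≤ hit T S := by
  rw [hit_eq]; split_ifs <;> norm_num

lemma hit_le_one (T S : Finset V) : hit T S ≤ 1 := min_le_right _ _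

lemma hit_eq_one {T S : Finset V} {v : V} (hS : v ∈ S) (hT : v ∈ T) : hit T S = 1 := by
  rw [hit_eq, if_pos ⟨v, hS, hT⟩]

lemma reachFun_eq {K : ℕ} (T : Fin K → Finset V) (β : Fin K → ℝ) (S : Finset V) :
    reachFun T β S = ∑ k, β k * hit (T k) S := rfl

/-- The law on indices with the given weights. -/
noncomputable def weightPMF {K : ℕ} (β : Fin K → ℝ) (hβ : β ∈ stdSimplex ℝ (Fin K)) :
    PMF (Fin K) :=
  PMF.ofFintype (fun k => ENNReal.ofReal (β k)) (by
    rw [← ENNReal.ofReal_sum_of_nonneg fun k _ => hβ.1 k, hβ.2, ENNReal.ofReal_one])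

lemma expect_weightPMF {K : ℕ} {β : Fin K → ℝ} (hβ : β ∈ stdSimplex ℝ (Fin K))
    (φ : Fin K → ℝ) : expect (weightPMF β hβ) φ = ∑ k, β k * φ k := by
  simp [expect, weightPMF, ENNReal.toReal_ofReal (hβ.1 _)]

lemma truncFun_eq_expect {K : ℕ} {β : Fin K → ℝ} (hβ : β ∈ stdSimplex ℝ (Fin K)) (lam : ℝ)
    (T : Fin K → Finset V) (S : Finset V) :
    truncFun lam T β S = (1 - 2 * lam) * expect (weightPMF β hβ) (fun k => hit (T k) S) + lam := by
  rw [expect_weightPMF, truncFun, reachFun_eq]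

lemma reachFun_mem {K : ℕ} {β : Fin K → ℝ} (hβ : β ∈ stdSimplex ℝ (Fin K))
    (T : Fin K → Finset V) (S : Finset V) : 0 ≤ reachFun T β S ∧ reachFun T β S ≤ 1 := by
  rw [reachFun_eq, ← expect_weightPMF hβ]
  exact ⟨expect_nonneg _ fun k => hit_nonneg _ _, expect_le _ fun k => hit_le_one _ _⟩

lemma truncFun_mem {K : ℕ} {β : Fin K → ℝ} (hβ : β ∈ stdSimplex ℝ (Fin K)) {lam : ℝ}
    (h1 : lam ≤ 1 / 2) (T : Fin K → Finset V) (S : Finset V) :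
    lam ≤ truncFun lam T β S ∧ truncFun lam T β S ≤ 1 - lam := by
  obtain ⟨h2, h3⟩ := reachFun_mem hβ T S
  rw [truncFun]
  constructor <;> nlinarith

variable {K m M : ℕ} {lam : ℝ}

/-- Uniform convergence over the sparse combinations implies uniform convergence over the
simplex. -/
lemma sum_logLik_le (h0 : 0 < lam) (h1 : lam ≤ 1 / 2) (hm : 0 < m) (T : Fin K → Finset V)
    (S : Fin M → Finset V) {u : Fin M → ℝ} (hu : ∀ i, 0 ≤ u i) (hsum : ∑ i, u i ≤ 2 * M)
    (P : PMF (Finset V)) {p : Finset V → ℝ} (hp : ∀ S, 0 ≤ p S) (hp' : ∀ S, p S ≤ 1) {t : ℝ}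
    (h : ∀ κ : Fin m → Fin K, ∑ i, logLik (u i) (truncAvg lam (fun k => hit (T k) (S i)) κ) ≤
      M * (expect P (fun S => logLik (p S) (truncAvg lam (fun k => hit (T k) S) κ)) + t))
    {β : Fin K → ℝ} (hβ : β ∈ stdSimplex ℝ (Fin K)) :
    ∑ i, logLik (u i) (truncFun lam T β (S i)) ≤
      M * (expect P (fun S => logLik (p S) (truncFun lam T β S)) + t + 3 * ((m : ℝ)⁻¹ / lam)) := by
  set c := (m : ℝ)⁻¹ / lam with hc
  have hc0 : 0 ≤ c := by positivity
  set Q := productPMF fun _ : Fin m => weightPMF β hβ with hQ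
  have step1 : ∑ i, logLik (u i) (truncFun lam T β (S i)) ≤
      expect Q (fun κ => ∑ i, logLik (u i) (truncAvg lam (fun k => hit (T k) (S i)) κ)) +
        c * (M + ∑ i, u i) := by
    have : c * (M + ∑ i, u i) = ∑ i, c * (1 + u i) := by
      rw [← Finset.mul_sum, Finset.sum_add_distrib]
      simp
    rw [this, expect_sum, ← Finset.sum_add_distrib]
    refine Finset.sum_le_sum fun i _ => ?_
    rw [truncFun_eq_expect hβ]
    exact logLik_le_expect_truncAvg _ h0 h1 (fun k => hit_nonneg _ _) (fun k => hit_le_one _ _)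
      hm (hu i)
  have step2 : expect Q (fun κ => expect P
      (fun S => logLik (p S) (truncAvg lam (fun k => hit (T k) S) κ))) ≤
      expect P (fun S => logLik (p S) (truncFun lam T β S)) := by
    rw [expect_comm]
    refine expect_mono _ fun S => ?_
    rw [truncFun_eq_expect hβ]
    exact expect_logLik_truncAvg_le _ h0 h1 (fun k => hit_nonneg _ _) (fun k => hit_le_one _ _)
      hm (hp S) (hp' S)
  have step3 := expect_mono Q h
  rw [expect_const_mul, expect_add, expect_const] at step3
  have hM : (0 : ℝ) ≤ M := Nat.cast_nonneg M
  -- Single labels can be as large as `1 / r`, but their average is at most 2, so the sparsification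
  -- error `c * (1 + u i)` averages to at most `3 * c`, free of `r`.
  have step4 : c * (M + ∑ i, u i) ≤ c * (3 * M) := mul_le_mul_of_nonneg_left (by linarith) hc0
  have step5 := mul_le_mul_of_nonneg_left step2 hM
  nlinarith

/-- The unbiased estimate of the activation of `v` from an incomplete cascade: seeds are always
observed, so no correction applies to them. -/
noncomputable def unbiasedLabel (r : ℝ) (v : V) (x : Finset V × Finset V) : ℝ :=
  if v ∈ x.1 then 1 else (if v ∈ x.2 then 1 else 0) / r

lemma unbiasedLabel_mem {r : ℝ} (hr : 0 < r) (hr1 : r ≤ 1) (v : V) (x : Finset V × Finset V) :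
    0 ≤ unbiasedLabel r v x ∧ unbiasedLabel r v x ≤ 1 / r := by
  have h : 1 ≤ 1 / r := by rwa [le_div_iff₀ hr, one_mul]
  have h' : (0 : ℝ) ≤ 1 / r := by positivity
  rw [unbiasedLabel]
  split_ifs
  · exact ⟨zero_le_one, h⟩
  · exact ⟨h', le_rfl⟩
  · rw [zero_div]
    exact ⟨le_rfl, h'⟩

/-- A maximizer of the noise-corrected log-likelihood beats, in unbiased log-likelihood, every
combination of features that contain `v`. -/
lemma IsFit.sum_logLik_le {r : ℝ} (hr : 0 < r) (hr1 : r ≤ 1) (h0 : 0 < lam) (h1 : lam ≤ 1 / 2)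
    {T : Fin K → Finset V} {s : Fin M → Finset V × Finset V} {v : V}
    (hs : ∀ i, (s i).1 ⊆ (s i).2) {β β' : Fin K → ℝ} (hβ : IsFit r lam T s v β)
    (hβ' : β' ∈ stdSimplex ℝ (Fin K)) (hv : ∀ S, v ∈ S → truncFun lam T β' S = 1 - lam) :
    ∑ i, logLik (unbiasedLabel r v (s i)) (truncFun lam T β' (s i).1) ≤
      ∑ i, logLik (unbiasedLabel r v (s i)) (truncFun lam T β (s i).1) := by
  have hfit : objective r lam T s v β' ≤ objective r lam T s v β := hβ.2 hβ'
  rw [← sub_nonneg] at hfit ⊢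
  refine hfit.trans ?_
  simp only [objective, ← Finset.sum_sub_distrib, corrLogLik_eq_logLik]
  refine Finset.sum_le_sum fun i _ => ?_
  -- The two likelihoods differ only here: the corrected label is `1 / r`, the unbiased one is 1. As
  -- `β'` attains the upper end `1 - lam`, passing to the unbiased label can only help `β` relative
  -- to `β'`.
  by_cases h : v ∈ (s i).1
  · obtain ⟨h2, h3⟩ := truncFun_mem hβ.1 h1 T (s i).1
    have h4 := logLik_one_sub_le h0 (h0.trans_le h2) h3
      (by rwa [le_div_iff₀ hr, one_mul] : 1 ≤ 1 / r)
    rw [hv _ h, unbiasedLabel, if_pos h, if_pos (hs i h)]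
    linarith
  · rw [unbiasedLabel, if_neg h]

/-! ### The law of incomplete cascades -/

lemma randomSubset_toReal {ι : Type*} [Fintype ι] [DecidableEq ι] (p : ι → I) (B : Finset ι) :
    (randomSubset p B).toReal = ∏ i, if i ∈ B then (p i : ℝ) else 1 - p i := by
  rw [randomSubset, PMF.ofFintype_apply, ENNReal.toReal_prod]
  refine Finset.prod_congr rfl fun i _ => ?_
  split_ifs
  · exact ENNReal.toReal_ofReal (p i).2.1
  · exact ENNReal.toReal_ofReal (sub_nonneg.2 (p i).2.2)

lemma prod_ite_mem_eq {ι : Type*} [Fintype ι] [DecidableEq ι] (f g : ι → ℝ) (B : Finset ι) :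
    (∏ i, if i ∈ B then f i else g i) = (∏ i ∈ B, f i) * ∏ i ∈ Finset.univ \ B, g i := by
  rw [Finset.prod_ite]
  congr 1
  · exact Finset.prod_congr (by ext; simp) fun _ _ => rfl
  · exact Finset.prod_congr (by ext; simp) fun _ _ => rfl

lemma expect_randomSubset_mem {ι : Type*} [Fintype ι] [DecidableEq ι] (p : ι → I) (i : ι) :
    expect (randomSubset p) (fun B => if i ∈ B then 1 else 0) = p i := by
  -- Setting the factor for absence of `i` to zero leaves exactly the subsets that contain `i` in
  -- the expanded product.
  have h := Finset.prod_add (fun j => (p j : ℝ)) (fun j => if j = i then 0 else 1 - (p j : ℝ))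
    Finset.univ
  rw [Finset.prod_eq_single i (by intro j _ hj; simp [hj]) (by simp), if_pos rfl, add_zero,
    Finset.powerset_univ] at h
  rw [h, expect]
  refine Finset.sum_congr rfl fun B _ => ?_
  rw [← prod_ite_mem_eq, randomSubset_toReal]
  by_cases hB : i ∈ B
  · rw [if_pos hB, mul_one]
    refine Finset.prod_congr rfl fun j _ => ?_
    by_cases hj : j = i
    · subst hj; simp [hB]
    · simp [hj]
  · rw [if_neg hB, mul_zero]
    exact (Finset.prod_eq_zero (Finset.mem_univ i) (by simp [hB])).symm

variable (P : PMF (Finset V)) (D : Finset V → PMF (Finset V)) (r : I)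

lemma expect_incompleteCascade (f : Finset V × Finset V → ℝ) :
    expect (incompleteCascade P D r) f = expect P fun S => expect (D S) fun A =>
      expect (randomSubset fun _ : V => r) fun R => f (S, S ∪ ((A \ S) ∩ R)) := by
  simp only [incompleteCascade, observed, expect_bind, expect_map]

lemma subset_of_incompleteCascade_ne_zero {x : Finset V × Finset V}
    (hx : incompleteCascade P D r x ≠ 0) : x.1 ⊆ x.2 := by
  rw [← PMF.mem_support_iff, incompleteCascade] at hx
  simp only [PMF.mem_support_bind_iff, PMF.mem_support_map_iff, observed] at hx
  obtain ⟨S, _, A, _, B, ⟨R, _, rfl⟩, rfl⟩ := hx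
  exact Finset.subset_union_left

lemma influence_mem (S : Finset V) (v : V) : 0 ≤ influence D S v ∧ influence D S v ≤ 1 :=
  ⟨prob_nonneg _ _, prob_le_one _ _⟩

variable {P D r}

/-- For a seed, label and influence are both 1; for any other node the retention probability cancels
the division by `r`. The affine form covers both the log-likelihood, which is affine in the label,
and the label itself. -/
lemma expect_unbiasedLabel (hr : 0 < r) {v : V}
    (hv : ∀ S, v ∈ S → influence D S v = 1) (g h : Finset V → ℝ) :
    expect (incompleteCascade P D r) (fun x => g x.1 + unbiasedLabel (r : ℝ) v x * h x.1) =
      expect P fun S => g S + influence D S v * h S := by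
  have hr' : (r : ℝ) ≠ 0 := (show (0 : ℝ) < r from hr).ne'
  rw [expect_incompleteCascade]
  congr 1
  ext S
  by_cases hS : v ∈ S
  · simp only [unbiasedLabel, hS, if_true, expect_const, hv S hS]
  · have h1 : ∀ A R : Finset V,
        g S + unbiasedLabel (r : ℝ) v (S, S ∪ ((A \ S) ∩ R)) * h S =
          g S + ((r : ℝ)⁻¹ * h S * if v ∈ A then 1 else 0) * if v ∈ R then 1 else 0 := by
      intro A R
      by_cases hA : v ∈ A <;> by_cases hR : v ∈ R <;> simp [unbiasedLabel, hS, hA, hR]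
    simp only [h1]
    simp only [expect_add, expect_const, expect_const_mul, expect_randomSubset_mem]
    have h2 : ∀ A : Finset V, ((r : ℝ)⁻¹ * h S * if v ∈ A then 1 else 0) * (r : ℝ) =
        h S * if v ∈ A then 1 else 0 := by
      intro A; field_simp
    simp only [h2, expect_const_mul]
    rw [influence, prob_eq_expect]
    ring

lemma expect_logLik_unbiasedLabel (hr : 0 < r) {v : V}
    (hv : ∀ S, v ∈ S → influence D S v = 1) (f : Finset V → ℝ) :
    expect (incompleteCascade P D r) (fun x => logLik (unbiasedLabel (r : ℝ) v x) (f x.1)) =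
      expect P fun S => logLik (influence D S v) (f S) := by
  have h : ∀ u t : ℝ, logLik u t = Real.log (1 - t) + u * (Real.log t - Real.log (1 - t)) := by
    intro u t; rw [logLik]; ring
  simp only [h]
  exact expect_unbiasedLabel hr hv (fun S => Real.log (1 - f S))
    fun S => Real.log (f S) - Real.log (1 - f S)

lemma expect_unbiasedLabel_le (hr : 0 < r) {v : V}
    (hv : ∀ S, v ∈ S → influence D S v = 1) :
    expect (incompleteCascade P D r) (unbiasedLabel (r : ℝ) v) ≤ 1 := by
  have h := expect_unbiasedLabel (P := P) hr hv (fun _ => 0) fun _ => 1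
  simp only [zero_add, mul_one] at h
  rw [show unbiasedLabel (r : ℝ) v = fun x => unbiasedLabel (r : ℝ) v x from rfl, h]
  exact expect_le _ fun S => (influence_mem D S v).2

lemma subset_of_trainingSet_ne_zero {M : ℕ} {s : Fin M → Finset V × Finset V}
    (hs : trainingSet P D r M s ≠ 0) (i : Fin M) : (s i).1 ⊆ (s i).2 := by
  rw [trainingSet, productPMF, PMF.ofFintype_apply, Finset.prod_ne_zero_iff] at hs
  exact subset_of_incompleteCascade_ne_zero P D r (hs i (Finset.mem_univ i))

/-! ### The maximum-likelihood fit on a random training set -/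

/-- Some combination of the features approximates the influence on `v` up to `lam`, outside an
exceptional set of seed sets of probability at most `ρ`, and is exact on seed sets containing
`v`. -/
def IsApproximable (P : PMF (Finset V)) (D : Finset V → PMF (Finset V)) (lam ρ : ℝ) (v : V)
    (T : Fin K → Finset V) (β : Fin K → ℝ) : Prop :=
  β ∈ stdSimplex ℝ (Fin K) ∧ (∀ S, v ∈ S → reachFun T β S = 1) ∧
    prob P (fun S => lam < |reachFun T β S - influence D S v|) ≤ ρ

/-- The cross-entropy excess of the approximating combination. -/
lemma IsApproximable.expect_logLik_le {ρ : ℝ} (h0 : 0 < lam) (h1 : lam ≤ 1 / 2) {v : V}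
    {T : Fin K → Finset V} {β : Fin K → ℝ} (h : IsApproximable P D lam ρ v T β) :
    expect P (fun S => logLik (influence D S v) (influence D S v)) -
      expect P (fun S => logLik (influence D S v) (truncFun lam T β S)) ≤
        8 * lam + ρ * (2 / lam) := by
  classical
  obtain ⟨hβ, _, hρ⟩ := h
  have key : ∀ S, logLik (influence D S v) (influence D S v) -
      logLik (influence D S v) (truncFun lam T β S) ≤
        8 * lam + 2 / lam * if lam < |reachFun T β S - influence D S v| then 1 else 0 := by
    intro S
    obtain ⟨hp, hp'⟩ := influence_mem D S v
    obtain ⟨hf, hf'⟩ := truncFun_mem hβ h1 T S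
    split_ifs with hS
    · refine (logLik_sub_le_of_abs_le (c := 1) h0 h1 hp hp' hf hf'
        (abs_le.2 ⟨by linarith, by linarith⟩)).trans ?_
      rw [one_pow, mul_one]
      linarith
    -- One `lam` is the approximation error, the other the shift caused by truncation.
    · refine (logLik_sub_le_of_abs_le (c := 2 * lam) h0 h1 hp hp' hf hf' ?_).trans (le_of_eq ?_)
      · rw [not_lt, abs_le] at hS
        rw [truncFun, abs_le]
        constructor <;> nlinarith
      · field_simp
        ring
  rw [← expect_sub]
  refine (expect_mono P key).trans ?_
  rw [expect_add, expect_const, expect_const_mul, ← prob_eq_expect, mul_comm ρ]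
  exact add_le_add le_rfl (mul_le_mul_of_nonneg_left hρ (by positivity))

/-- If the training set is representative, then every fit is accurate. -/
lemma IsApproximable.expect_sq_le {ρ t : ℝ} (hr : 0 < r) (h0 : 0 < lam) (h1 : lam ≤ 1 / 2)
    (hm : 0 < m) (hM : 0 < M) {v : V} {T : Fin K → Finset V} {β' : Fin K → ℝ}
    (h : IsApproximable P D lam ρ v T β') {s : Fin M → Finset V × Finset V}
    (hs : ∀ i, (s i).1 ⊆ (s i).2)
    (hsum : ∑ i, unbiasedLabel (r : ℝ) v (s i) ≤ 2 * M)
    (hup : ∀ κ : Fin m → Fin K,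
      ∑ i, logLik (unbiasedLabel (r : ℝ) v (s i))
        (truncAvg lam (fun k => hit (T k) (s i).1) κ) ≤
      M * (expect P (fun S => logLik (influence D S v)
        (truncAvg lam (fun k => hit (T k) S) κ)) + t))
    (hlow : M * (expect P (fun S => logLik (influence D S v) (truncFun lam T β' S)) - t) ≤
      ∑ i, logLik (unbiasedLabel (r : ℝ) v (s i)) (truncFun lam T β' (s i).1))
    {β : Fin K → ℝ} (hβ : IsFit (r : ℝ) lam T s v β) :
    expect P (fun S => (truncFun lam T β S - influence D S v) ^ 2) ≤
      2 * (8 * lam + ρ * (2 / lam) + 2 * t + 3 * ((m : ℝ)⁻¹ / lam)) := by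
  have hr0 : (0 : ℝ) < r := hr
  have hr1 : (r : ℝ) ≤ 1 := r.2.2
  have hv : ∀ S, v ∈ S → truncFun lam T β' S = 1 - lam := by
    intro S hS
    rw [truncFun, h.2.1 S hS]
    ring
  have e1 := hβ.sum_logLik_le hr0 hr1 h0 h1 hs h.1 hv
  have e2 := sum_logLik_le h0 h1 hm T (fun i => (s i).1)
    (fun i => (unbiasedLabel_mem hr0 hr1 v (s i)).1) hsum P (fun S => (influence_mem D S v).1)
    (fun S => (influence_mem D S v).2) hup hβ.1
  -- The comparison runs from the expected value at `β'` through the empirical values at `β'` and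
  -- `β` to the expected value at `β`. Hence a lower deviation bound is needed only at `β'`, and
  -- uniformity only from above.
  have e3 := le_of_mul_le_mul_left (hlow.trans (e1.trans e2)) (by positivity : (0 : ℝ) < M)
  have e4 := h.expect_logLik_le h0 h1
  have e5 : expect P (fun S => (truncFun lam T β S - influence D S v) ^ 2) ≤
      expect P (fun S => 2 * (logLik (influence D S v) (influence D S v) -
        logLik (influence D S v) (truncFun lam T β S))) := by
    refine expect_mono P fun S => ?_
    obtain ⟨hf, hf'⟩ := truncFun_mem hβ.1 h1 T S
    rw [sub_sq_comm]
    exact sq_sub_le_logLik (influence_mem D S v).1 (influence_mem D S v).2 (h0.trans_le hf)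
      (by linarith)
  rw [expect_const_mul, expect_sub] at e5
  linarith

lemma prob_trainingSet_logLik {t : ℝ} (hr : 0 < r) (h0 : 0 < lam) (h1 : lam < 1 / 2)
    (ht : 0 ≤ t) {v : V} (f : Finset V → ℝ) (hf : ∀ S, lam ≤ f S ∧ f S ≤ 1 - lam) :
    prob (trainingSet P D r M) (fun s =>
        M * (expect (incompleteCascade P D r)
          (fun x => logLik (unbiasedLabel (r : ℝ) v x) (f x.1)) + t) ≤
        ∑ i, logLik (unbiasedLabel (r : ℝ) v (s i)) (f (s i).1)) ≤
      Real.exp (-(2 * M * t ^ 2 / (4 * (1 / r) * Real.log (1 / lam)) ^ 2)) ∧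
    prob (trainingSet P D r M) (fun s =>
        ∑ i, logLik (unbiasedLabel (r : ℝ) v (s i)) (f (s i).1) ≤
        M * (expect (incompleteCascade P D r)
          (fun x => logLik (unbiasedLabel (r : ℝ) v x) (f x.1)) - t)) ≤
      Real.exp (-(2 * M * t ^ 2 / (4 * (1 / r) * Real.log (1 / lam)) ^ 2)) := by
  have hr0 : (0 : ℝ) < r := hr
  have hr1 : (r : ℝ) ≤ 1 := r.2.2
  have hr2 : 1 ≤ 1 / (r : ℝ) := by rwa [le_div_iff₀ hr0, one_mul]
  set b := 2 * (1 / (r : ℝ)) * Real.log (1 / lam) with hb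
  have hb0 : 0 < b := by
    have : 0 < Real.log (1 / lam) := Real.log_pos (by rw [lt_div_iff₀ h0]; linarith)
    positivity
  have hbb : 4 * (1 / r) * Real.log (1 / lam) = b - -b := by rw [hb]; ring
  have range : ∀ x, incompleteCascade P D r x ≠ 0 →
      -b ≤ logLik (unbiasedLabel (r : ℝ) v x) (f x.1) ∧
        logLik (unbiasedLabel (r : ℝ) v x) (f x.1) ≤ b := by
    intro x _
    obtain ⟨hu, hu'⟩ := unbiasedLabel_mem hr0 hr1 v x
    exact abs_le.1 (abs_logLik_le h0 (hf _).1 (hf _).2 hu hu' hr2)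
  rw [hbb]
  exact ⟨hoeffding (incompleteCascade P D r) M (by linarith) range ht,
    hoeffding_lower (incompleteCascade P D r) M (by linarith) range ht⟩

/-- The labels have mean at most 1 and range `1 / r`; this is Hoeffding with deviation 1. -/
lemma prob_trainingSet_unbiasedLabel (hr : 0 < r) {v : V}
    (hv : ∀ S, v ∈ S → influence D S v = 1) :
    prob (trainingSet P D r M) (fun s => 2 * M ≤ ∑ i, unbiasedLabel (r : ℝ) v (s i)) ≤
      Real.exp (-(2 * M * (r : ℝ) ^ 2)) := by
  have hr0 : (0 : ℝ) < r := hr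
  have hr1 : (r : ℝ) ≤ 1 := r.2.2
  have h := hoeffding (incompleteCascade P D r) M (f := unbiasedLabel (r : ℝ) v) (a := 0)
    (b := 1 / r) (by positivity) (fun x _ => unbiasedLabel_mem hr0 hr1 v x) zero_le_one
  have e : 2 * M * (1 : ℝ) ^ 2 / (1 / r - 0) ^ 2 = 2 * M * (r : ℝ) ^ 2 := by field_simp; ring
  rw [e] at h
  refine le_trans (prob_mono _ fun s hs => ?_) h
  have := expect_unbiasedLabel_le (P := P) hr hv
  nlinarith [(Nat.cast_nonneg M : (0 : ℝ) ≤ M)]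

/-- With high probability over the training set every fit is accurate. -/
lemma IsApproximable.prob_trainingSet_le {ρ t : ℝ} (hr : 0 < r) (h0 : 0 < lam)
    (h1 : lam < 1 / 2) (ht : 0 ≤ t) (hm : 0 < m) (hM : 0 < M) {v : V}
    (hv : ∀ S, v ∈ S → influence D S v = 1) {T : Fin K → Finset V} {β' : Fin K → ℝ}
    (h : IsApproximable P D lam ρ v T β') :
    prob (trainingSet P D r M) (fun s => ¬ ∀ β, IsFit (r : ℝ) lam T s v β →
      expect P (fun S => (truncFun lam T β S - influence D S v) ^ 2) ≤
        2 * (8 * lam + ρ * (2 / lam) + 2 * t + 3 * ((m : ℝ)⁻¹ / lam))) ≤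
      (K ^ m + 1) * Real.exp (-(2 * M * t ^ 2 / (4 * (1 / r) * Real.log (1 / lam)) ^ 2)) +
        Real.exp (-(2 * M * (r : ℝ) ^ 2)) := by
  -- the three ways in which the training set can fail to be representative
  let L (f : Finset V → ℝ) (x : Finset V × Finset V) : ℝ :=
    logLik (unbiasedLabel (r : ℝ) v x) (f x.1)
  let sparse (κ : Fin m → Fin K) (S : Finset V) : ℝ := truncAvg lam (fun k => hit (T k) S) κ
  let bad₁ (s : Fin M → Finset V × Finset V) : Prop :=
    2 * M ≤ ∑ i, unbiasedLabel (r : ℝ) v (s i)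
  let bad₂ (κ : Fin m → Fin K) (s : Fin M → Finset V × Finset V) : Prop :=
    M * (expect (incompleteCascade P D r) (L (sparse κ)) + t) ≤ ∑ i, L (sparse κ) (s i)
  let bad₃ (s : Fin M → Finset V × Finset V) : Prop :=
    ∑ i, L (truncFun lam T β') (s i) ≤
      M * (expect (incompleteCascade P D r) (L (truncFun lam T β')) - t)
  have hbad₂ : ∀ κ, prob (trainingSet P D r M) (bad₂ κ) ≤
      Real.exp (-(2 * M * t ^ 2 / (4 * (1 / r) * Real.log (1 / lam)) ^ 2)) := by
    intro κ
    refine (prob_trainingSet_logLik hr h0 h1 ht (sparse κ) fun S => ⟨?_, ?_⟩).1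
    · exact le_truncAvg h1.le (fun k => hit_nonneg _ _) κ
    · have := le_truncAvg h1.le (φ := fun k => 1 - hit (T k) S)
        (fun k => sub_nonneg.2 (hit_le_one _ _)) κ
      rw [← one_sub_truncAvg lam _ hm] at this
      linarith
  have hbad₃ : prob (trainingSet P D r M) bad₃ ≤
      Real.exp (-(2 * M * t ^ 2 / (4 * (1 / r) * Real.log (1 / lam)) ^ 2)) :=
    (prob_trainingSet_logLik hr h0 h1 ht _ fun S => truncFun_mem h.1 h1.le T S).2
  have cover : prob (trainingSet P D r M) (fun s => ¬ ∀ β, IsFit (r : ℝ) lam T s v β →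
      expect P (fun S => (truncFun lam T β S - influence D S v) ^ 2) ≤
        2 * (8 * lam + ρ * (2 / lam) + 2 * t + 3 * ((m : ℝ)⁻¹ / lam))) ≤
      prob (trainingSet P D r M) (fun s => ((∃ κ, bad₂ κ s) ∨ bad₃ s) ∨ bad₁ s) := by
    refine prob_mono_of_ne_zero _ fun s hs => not_imp_comm.1 fun hbad β hβ => ?_
    rw [not_or, not_or, not_exists] at hbad
    obtain ⟨⟨h2, h3⟩, h4⟩ := hbad
    refine h.expect_sq_le hr h0 h1.le hm hM (subset_of_trainingSet_ne_zero hs) (not_le.1 h4).le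
      (fun κ => ?_) ?_ hβ
    · have e := expect_logLik_unbiasedLabel (P := P) hr hv (sparse κ)
      exact e ▸ (not_le.1 (h2 κ)).le
    · have e := expect_logLik_unbiasedLabel (P := P) hr hv (truncFun lam T β')
      exact e ▸ (not_le.1 h3).le
  refine cover.trans ((prob_or_le _ _ _).trans (add_le_add ((prob_or_le _ _ _).trans ?_)
    (prob_trainingSet_unbiasedLabel hr hv)))
  -- There is one event for each of the `K ^ m` sparse averages and one more for `β'`.
  rw [add_one_mul]
  refine add_le_add ((prob_exists_le _ _).trans ((Finset.sum_le_sum fun κ _ => hbad₂ κ).trans ?_))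
    hbad₃
  simp

end Sample

/-! ### Random reachability features -/

section Features

variable {V : Type*} [Fintype V] [DecidableEq V]

lemma mem_of_reachDist_ne_zero {Γ : PMF (Finset (V × V))} {v : V} {T : Finset V}
    (hT : reachDist Γ v T ≠ 0) : v ∈ T := by
  rw [← PMF.mem_support_iff, reachDist, PMF.mem_support_map_iff] at hT
  obtain ⟨L, _, rfl⟩ := hT
  exact mem_reachSet.2 .refl

lemma IsLiveEdgeDist.influence_eq {E : Finset (V × V)} {D : Finset V → PMF (Finset V)} {v : V}
    {Γ : PMF (Finset (V × V))} (h : IsLiveEdgeDist E D v Γ) (S : Finset V) :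
    influence D S v = expect (reachDist Γ v) fun T => hit T S := by
  classical
  rw [h.2 S, reachDist, expect_map, prob_eq_expect]
  simp only [hit_eq]

lemma IsLiveEdgeDist.influence_eq_one {E : Finset (V × V)} {D : Finset V → PMF (Finset V)}
    {v : V} {Γ : PMF (Finset (V × V))} (h : IsLiveEdgeDist E D v Γ) (S : Finset V) (hS : v ∈ S) :
    influence D S v = 1 := by
  rw [h.influence_eq S, ← expect_const (reachDist Γ v) 1]
  exact expect_congr_of_ne_zero _ fun T hT => hit_eq_one hS (mem_of_reachDist_ne_zero hT)

lemma IsLiveEdgeDist.influence_empty {E : Finset (V × V)} {D : Finset V → PMF (Finset V)}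
    {v : V} {Γ : PMF (Finset (V × V))} (h : IsLiveEdgeDist E D v Γ) :
    influence D ∅ v = 0 := by
  rw [h.influence_eq]
  simp [hit_eq, expect_const]

/-- The importance weight of a feature. -/
noncomputable def importance {α : Type*} (γ q : PMF α) (T : α) : ℝ :=
  (γ T).toReal / (q T).toReal

/-! ### Importance weights -/

section Importance

variable {α : Type*} {γ q : PMF α} {C : ℝ}

lemma importance_nonneg (T : α) : 0 ≤ importance γ q T := by
  rw [importance]; positivity

lemma importance_le (h : ∀ T, (γ T).toReal ≤ C * (q T).toReal) {T : α} (hT : q T ≠ 0) :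
    importance γ q T ≤ C :=
  (div_le_iff₀ (ENNReal.toReal_pos hT (q.apply_ne_top T))).2 (h T)

lemma expect_importance [Fintype α] (h : ∀ T, (γ T).toReal ≤ C * (q T).toReal) (g : α → ℝ) :
    expect q (fun T => importance γ q T * g T) = expect γ g := by
  refine Finset.sum_congr rfl fun T _ => ?_
  by_cases hq : (q T).toReal = 0
  · have : (γ T).toReal = 0 :=
      le_antisymm (by simpa [hq] using h T) ENNReal.toReal_nonneg
    simp [hq, this]
  · simp only [importance]
    rw [← mul_assoc, mul_div_cancel₀ _ hq]

lemma one_le_of_le_mul [Fintype α] (h : ∀ T, (γ T).toReal ≤ C * (q T).toReal) : 1 ≤ C := by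
  have := Finset.sum_le_sum fun T (_ : T ∈ Finset.univ) => h T
  rwa [← Finset.mul_sum, sum_toReal_eq_one, sum_toReal_eq_one, mul_one] at this

end Importance

/-- The importance-weighted empirical mean of the features deviates at `S`, or the total weight
deviates. -/
def Deviates (γ q : PMF (Finset V)) {K : ℕ} (η : ℝ) (T : Fin K → Finset V) (S : Finset V) : Prop :=
  ((K * (expect γ (fun T => hit T S) + η) ≤ ∑ k, importance γ q (T k) * hit (T k) S ∨
      ∑ k, importance γ q (T k) * hit (T k) S ≤ K * (expect γ (fun T => hit T S) - η)) ∨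
    (K * (1 + η) ≤ ∑ k, importance γ q (T k) ∨ ∑ k, importance γ q (T k) ≤ K * (1 - η)))

variable {γ q : PMF (Finset V)} {C : ℝ}

lemma prob_deviates_le (h : ∀ T, (γ T).toReal ≤ C * (q T).toReal) (K : ℕ) {η : ℝ} (hη : 0 ≤ η)
    (S : Finset V) :
    prob (productPMF fun _ : Fin K => q) (fun T => Deviates γ q η T S) ≤
      4 * Real.exp (-(2 * K * η ^ 2 / C ^ 2)) := by
  have hC : 0 < C := zero_lt_one.trans_le (one_le_of_le_mul h)
  have r1 : ∀ T, q T ≠ 0 → 0 ≤ importance γ q T * hit T S ∧ importance γ q T * hit T S ≤ C :=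
    fun T hT => ⟨mul_nonneg (importance_nonneg T) (hit_nonneg T S),
      (mul_le_of_le_one_right (importance_nonneg T) (hit_le_one T S)).trans (importance_le h hT)⟩
  have r2 : ∀ T, q T ≠ 0 → 0 ≤ importance γ q T ∧ importance γ q T ≤ C :=
    fun T hT => ⟨importance_nonneg T, importance_le h hT⟩
  have e2 : expect q (importance γ q) = 1 := by
    have := expect_importance h fun _ => 1
    simpa [expect_const] using this
  have h1 := hoeffding q K hC r1 hη
  have h2 := hoeffding_lower q K hC r1 hη
  have h3 := hoeffding q K hC r2 hη
  have h4 := hoeffding_lower q K hC r2 hη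
  rw [expect_importance h, sub_zero] at h1 h2
  rw [e2, sub_zero] at h3 h4
  have h5 := (prob_or_le _ _ _).trans (add_le_add h1 h2)
  have h6 := (prob_or_le _ _ _).trans (add_le_add h3 h4)
  refine ((prob_or_le _ _ _).trans (add_le_add h5 h6)).trans (le_of_eq ?_)
  ring

/-- Dividing by the actual total weight `W` instead of `K` costs `A / W * |K - W| / K`, which is at
most `η` because `A ≤ W`. -/
lemma abs_reweighted_sub_lt {A W K p η : ℝ} (hK : 0 < K) (hη' : η ≤ 1) (hA : 0 ≤ A) (hAW : A ≤ W)
    (h1 : A < K * (p + η)) (h2 : K * (p - η) < A) (h3 : W < K * (1 + η))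
    (h4 : K * (1 - η) < W) : |A / W - p| ≤ 2 * η := by
  have hW : 0 < W := lt_of_le_of_lt (mul_nonneg hK.le (by linarith)) h4
  have e : A / W - p = (A / K - p) + A / W * ((K - W) / K) := by
    field_simp
    ring
  have b1 : |A / K - p| ≤ η := by
    rw [abs_le, le_sub_iff_add_le, sub_le_iff_le_add, le_div_iff₀ hK, div_le_iff₀ hK]
    constructor <;> nlinarith
  have b2 : |(K - W) / K| ≤ η := by
    rw [abs_le, le_div_iff₀ hK, div_le_iff₀ hK]
    constructor <;> nlinarith
  have b3 : |A / W| ≤ 1 := by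
    rw [abs_of_nonneg (div_nonneg hA hW.le)]
    exact (div_le_one hW).2 hAW
  rw [e]
  refine (abs_add_le _ _).trans ?_
  rw [abs_mul]
  nlinarith [abs_nonneg (A / W), abs_nonneg ((K - W) / K),
    mul_le_mul b3 b2 (abs_nonneg _) zero_le_one]

lemma exists_isApproximable {P : PMF (Finset V)} {D : Finset V → PMF (Finset V)} {v : V}
    (hinf : ∀ S, influence D S v = expect γ fun T => hit T S) (hmem : ∀ T, γ T ≠ 0 → v ∈ T)
    {K : ℕ} (hK : 0 < K) {η ρ : ℝ} (hη' : η ≤ 1) (hρ : ρ < 1) {T : Fin K → Finset V}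
    (h : prob P (fun S => Deviates γ q η T S) ≤ ρ) :
    ∃ β, IsApproximable P D (2 * η) ρ v T β := by
  have hK' : (0 : ℝ) < K := Nat.cast_pos.2 hK
  have good : ∀ S, ¬ Deviates γ q η T S →
      K * (1 - η) < ∑ k, importance γ q (T k) ∧
      |(∑ k, importance γ q (T k) * hit (T k) S) / ∑ k, importance γ q (T k) -
        influence D S v| ≤ 2 * η := by
    intro S hS
    rw [Deviates, not_or, not_or, not_or, not_le, not_le, not_le, not_le, ← hinf] at hS
    obtain ⟨⟨h1, h2⟩, h3, h4⟩ := hS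
    exact ⟨h4, abs_reweighted_sub_lt hK' hη'
      (Finset.sum_nonneg fun k _ => mul_nonneg (importance_nonneg _) (hit_nonneg _ _))
      (Finset.sum_le_sum fun k _ => mul_le_of_le_one_right (importance_nonneg _) (hit_le_one _ _))
      h1 h2 h3 h4⟩
  -- The condition on the total weight does not involve `S`, so a single good `S`, which exists
  -- since `ρ < 1`, makes it hold and keeps the normalisation positive.
  have hex : ∃ S, ¬ Deviates γ q η T S := by
    by_contra! hall
    have : prob P (fun S => Deviates γ q η T S) = 1 := by
      classical
      rw [prob_eq_expect]
      simp [hall, expect_const]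
    linarith
  obtain ⟨S₀, hS₀⟩ := hex
  set W := ∑ k, importance γ q (T k) with hWdef
  have hW : 0 < W := lt_of_le_of_lt (mul_nonneg hK'.le (by linarith)) (good S₀ hS₀).1
  have hreach : ∀ S, reachFun T (fun k => importance γ q (T k) / W) S =
      (∑ k, importance γ q (T k) * hit (T k) S) / W := by
    intro S
    rw [reachFun_eq, Finset.sum_div]
    exact Finset.sum_congr rfl fun k _ => by ring
  refine ⟨fun k => importance γ q (T k) / W,
    ⟨fun k => div_nonneg (importance_nonneg _) hW.le, ?_⟩, fun S hS => ?_, ?_⟩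
  · rw [← Finset.sum_div, ← hWdef, div_self hW.ne']
  -- Features of positive weight lie in the support of `γ`, hence contain `v`. This gives exactness
  -- at every `S` containing `v`, deviating or not.
  · have : ∑ k, importance γ q (T k) * hit (T k) S = W := by
      refine Finset.sum_congr rfl fun k _ => ?_
      by_cases hk : γ (T k) = 0
      · simp [importance, hk]
      · rw [hit_eq_one hS (hmem _ hk), mul_one]
    rw [hreach, this, div_self hW.ne']
  · refine le_trans (prob_mono P fun S hS => ?_) h
    by_contra hdev
    rw [hreach] at hS
    exact absurd (good S hdev).2 (not_le.2 hS)

/-- With high probability some combination of the random features is a good approximation. -/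
lemma prob_not_isApproximable_le {P : PMF (Finset V)} {D : Finset V → PMF (Finset V)} {v : V}
    (hinf : ∀ S, influence D S v = expect γ fun T => hit T S) (hmem : ∀ T, γ T ≠ 0 → v ∈ T)
    (h : ∀ T, (γ T).toReal ≤ C * (q T).toReal)
    {K : ℕ} (hK : 0 < K) {η ρ : ℝ} (hη : 0 ≤ η) (hη' : η ≤ 1) (hρ0 : 0 < ρ) (hρ : ρ < 1) :
    prob (productPMF fun _ : Fin K => q) (fun T => ¬ ∃ β, IsApproximable P D (2 * η) ρ v T β) ≤
      4 * Real.exp (-(2 * K * η ^ 2 / C ^ 2)) / ρ := by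
  classical
  have h1 : prob (productPMF fun _ : Fin K => q)
      (fun T => ¬ ∃ β, IsApproximable P D (2 * η) ρ v T β) ≤
      prob (productPMF fun _ : Fin K => q) (fun T => ρ < prob P fun S => Deviates γ q η T S) :=
    prob_mono _ fun T hT => not_le.1 fun hle =>
      hT (exists_isApproximable hinf hmem hK hη' hρ hle)
  refine h1.trans ((prob_lt_le_div _ (fun T => prob_nonneg _ _) hρ0).trans ?_)
  refine div_le_div_of_nonneg_right ?_ hρ0.le
  simp only [prob_eq_expect]
  -- Hoeffding holds for each fixed seed set; exchanging the averages turns it into a bound for the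
  -- mean measure of the exceptional set, to which Markov has been applied.
  rw [expect_comm]
  refine expect_le P fun S => ?_
  rw [← prob_eq_expect]
  exact prob_deviates_le h K hη S

/-! ### Accuracy of the fit on a random training set with random features -/

/-- By independence the features may be fixed first, so that the approximating combination does not
depend on the training set. -/
lemma prob_experiment {P : PMF (Finset V)} {D : Finset V → PMF (Finset V)} {r : I}
    {q : V → PMF (Finset V)} {M K : ℕ}
    (e : (Fin M → Finset V × Finset V) × (V → Fin K → Finset V) → Prop) :
    prob (experiment P D r q M K) e =
      expect (featureLaw q K) fun T => prob (trainingSet P D r M) fun s => e (s, T) := by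
  classical
  rw [experiment, prob_bind]
  simp only [prob_map]
  simp only [prob_eq_expect]
  exact expect_comm _ _ _

/-- Truncation keeps both logarithms away from zero, so the objective is continuous on the compact
simplex. -/
lemma exists_isFit {K M : ℕ} (hK : 0 < K) {r lam : ℝ} (h0 : 0 < lam) (h1 : lam ≤ 1 / 2)
    (T : Fin K → Finset V) (s : Fin M → Finset V × Finset V) (v : V) :
    ∃ β, IsFit r lam T s v β := by
  have hne : (stdSimplex ℝ (Fin K)).Nonempty :=
    ⟨_, single_mem_stdSimplex ℝ (⟨0, hK⟩ : Fin K)⟩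
  have hcont : ContinuousOn (objective r lam T s v) (stdSimplex ℝ (Fin K)) := by
    have ht : ∀ S, Continuous fun β : Fin K → ℝ => truncFun lam T β S := by
      intro S
      simp only [truncFun, reachFun]
      fun_prop
    refine continuousOn_finsetSum _ fun i _ => ContinuousOn.add
      (continuousOn_const.mul (ContinuousOn.log (ht _).continuousOn fun β hβ => ?_))
      (continuousOn_const.mul (ContinuousOn.log (continuousOn_const.sub (ht _).continuousOn)
        fun β hβ => ?_))
    · exact (h0.trans_le (truncFun_mem hβ h1 T _).1).ne'
    · have := (truncFun_mem hβ h1 T (s i).1).2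
      linarith
  obtain ⟨β, hβ, hmax⟩ := (isCompact_stdSimplex ℝ (Fin K)).exists_isMaxOn hne hcont
  exact ⟨β, hβ, hmax⟩

/-- The failure probability for a single node. -/
lemma prob_experiment_inaccurate_le {P : PMF (Finset V)} {D : Finset V → PMF (Finset V)} {r : I}
    {q : V → PMF (Finset V)} {v : V} {M K m : ℕ} {lam ρ t : ℝ}
    (hinf : ∀ S, influence D S v = expect γ fun T => hit T S) (hmem : ∀ T, γ T ≠ 0 → v ∈ T)
    (hv : ∀ S, v ∈ S → influence D S v = 1)
    (h : ∀ T, (γ T).toReal ≤ C * (q v T).toReal) (hr : 0 < r) (h0 : 0 < lam) (h1 : lam < 1 / 2)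
    (hρ0 : 0 < ρ) (hρ : ρ < 1) (ht : 0 ≤ t) (hm : 0 < m) (hM : 0 < M) (hK : 0 < K) :
    prob (experiment P D r q M K) (fun x => ¬ ∀ β, IsFit (r : ℝ) lam (x.2 v) x.1 v β →
      expect P (fun S => (truncFun lam (x.2 v) β S - influence D S v) ^ 2) ≤
        2 * (8 * lam + ρ * (2 / lam) + 2 * t + 3 * ((m : ℝ)⁻¹ / lam))) ≤
      4 * Real.exp (-(2 * K * (lam / 2) ^ 2 / C ^ 2)) / ρ +
      ((K ^ m + 1) * Real.exp (-(2 * M * t ^ 2 / (4 * (1 / r) * Real.log (1 / lam)) ^ 2)) +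
        Real.exp (-(2 * M * (r : ℝ) ^ 2))) := by
  classical
  set B := (K ^ m + 1) * Real.exp (-(2 * M * t ^ 2 / (4 * (1 / r) * Real.log (1 / lam)) ^ 2)) +
        Real.exp (-(2 * M * (r : ℝ) ^ 2)) with hB
  have hB0 : 0 ≤ B := by positivity
  rw [prob_experiment]
  have key : ∀ T : V → Fin K → Finset V, prob (trainingSet P D r M) (fun s =>
      ¬ ∀ β, IsFit (r : ℝ) lam (T v) s v β →
        expect P (fun S => (truncFun lam (T v) β S - influence D S v) ^ 2) ≤
          2 * (8 * lam + ρ * (2 / lam) + 2 * t + 3 * ((m : ℝ)⁻¹ / lam))) ≤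
      (if ¬ ∃ β, IsApproximable P D (2 * (lam / 2)) ρ v (T v) β then 1 else 0) + B := by
    intro T
    by_cases hT : ∃ β, IsApproximable P D (2 * (lam / 2)) ρ v (T v) β
    swap
    · rw [if_pos hT]
      exact (prob_le_one _ _).trans (by linarith)
    · rw [if_neg (not_not.2 hT)]
      obtain ⟨β', hβ'⟩ := hT
      rw [mul_div_cancel₀ lam two_ne_zero] at hβ'
      exact (hβ'.prob_trainingSet_le hr h0 h1 ht hm hM hv).trans (by rw [zero_add])
  refine (expect_mono _ key).trans ?_
  rw [expect_add, expect_const, ← prob_eq_expect]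
  refine add_le_add ?_ le_rfl
  rw [featureLaw, prob_productPMF_eval (fun v => productPMF fun _ : Fin K => q v) v
    (fun T => ¬ ∃ β, IsApproximable P D (2 * (lam / 2)) ρ v T β)]
  exact prob_not_isApproximable_le hinf hmem h hK (by linarith) (by linarith) hρ0 hρ

end Features

/-! ### The choice of the parameters -/

section Parameters

variable {ε δ : ℝ} {n : ℕ}

lemma one_add_log_le_logTerm (hn : 0 < n) (hε : 0 < ε) (hδ : 0 < δ) (hδ1 : δ < 1) :
    1 + Real.log (1 / ε) ≤ logTerm n ε δ := by
  have h3 : (1 : ℝ) ≤ Real.log 3 := by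
    rw [Real.le_log_iff_exp_le (by norm_num)]
    linarith [Real.exp_one_lt_d9]
  have hn1 : (1 : ℝ) ≤ n := by exact_mod_cast hn
  calc 1 + Real.log (1 / ε) ≤ Real.log 3 + Real.log (1 / ε) := by linarith
    _ = Real.log (3 * (1 / ε)) := (Real.log_mul (by norm_num) (by positivity)).symm
    _ ≤ logTerm n ε δ := by
      refine Real.log_le_log (by positivity) ?_
      rw [mul_one_div]
      refine div_le_div₀ (by positivity) (by linarith) (by positivity) ?_
      exact mul_le_of_le_one_right hε.le hδ1.le

lemma exp_neg_logTerm (hn : 0 < n) (hε : 0 < ε) (hδ : 0 < δ) :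
    Real.exp (-logTerm n ε δ) = ε * δ / (3 * n) := by
  have hn1 : (0 : ℝ) < n := by exact_mod_cast hn
  rw [Real.exp_neg, logTerm, Real.exp_log (by positivity), inv_div]

lemma log_one_div_nonneg (hε : 0 < ε) (hε1 : ε < 1) : 0 ≤ Real.log (1 / ε) :=
  Real.log_nonneg (by rw [le_div_iff₀ hε]; linarith)

lemma truncLevel_pos (hε : 0 < ε) (hε1 : ε < 1) : 0 < truncLevel 64 ε := by
  have := log_one_div_nonneg hε hε1
  rw [truncLevel]
  positivity

lemma truncLevel_le (hε : 0 < ε) (hε1 : ε < 1) : truncLevel 64 ε ≤ ε / 64 := by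
  have := log_one_div_nonneg hε hε1
  rw [truncLevel]
  exact div_le_div_of_nonneg_left hε.le (by norm_num) (by linarith)

lemma one_div_truncLevel_le (hn : 0 < n) (hε : 0 < ε) (hδ : 0 < δ) (hδ1 : δ < 1) :
    1 / truncLevel 64 ε ≤ 64 * logTerm n ε δ / ε := by
  rw [truncLevel, one_div_div]
  have := one_add_log_le_logTerm hn hε hδ hδ1
  gcongr

lemma one_div_truncLevel_le_sq (hε : 0 < ε) : 1 / truncLevel 64 ε ≤ 64 / ε ^ 2 := by
  rw [truncLevel, one_div_div]
  have := Real.log_le_sub_one_of_pos (one_div_pos.2 hε)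
  calc 64 * (1 + Real.log (1 / ε)) / ε ≤ 64 * (1 / ε) / ε := by gcongr; linarith
    _ = 64 / ε ^ 2 := by field_simp

lemma log_one_div_truncLevel_le (hn : 0 < n) (hε : 0 < ε) (hε1 : ε < 1) (hδ : 0 < δ)
    (hδ1 : δ < 1) : Real.log (1 / truncLevel 64 ε) ≤ 5 * logTerm n ε δ := by
  have h1 := one_add_log_le_logTerm hn hε hδ hδ1
  have h2 := log_one_div_nonneg hε hε1
  have h3 : Real.log 64 ≤ 5 := by
    rw [show (64 : ℝ) = 2 ^ 6 by norm_num, Real.log_pow]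
    have := Real.log_two_lt_d9
    norm_num
    linarith
  calc Real.log (1 / truncLevel 64 ε) ≤ Real.log (64 / ε ^ 2) :=
      Real.log_le_log (one_div_pos.2 (truncLevel_pos hε hε1)) (one_div_truncLevel_le_sq hε)
    _ = Real.log 64 + 2 * Real.log (1 / ε) := by
      rw [Real.log_div (by norm_num) (by positivity), Real.log_pow, one_div, Real.log_inv]
      push_cast
      ring
    _ ≤ 5 * logTerm n ε δ := by linarith

/-- The number of sampled features suffices for the approximation of all influences. -/
lemma feature_failure_le {C K : ℝ} (hn : 0 < n) (hε : 0 < ε) (hε1 : ε < 1) (hδ : 0 < δ)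
    (hδ1 : δ < 1) (hC : 1 ≤ C) (hK : 163840 * (C ^ 2 / ε ^ 2) * logTerm n ε δ ^ 3 ≤ K) :
    4 * Real.exp (-(2 * K * (truncLevel 64 ε / 2) ^ 2 / C ^ 2)) / (ε ^ 3 / 1024) ≤
      δ / (3 * n) := by
  have hn1 : (1 : ℝ) ≤ n := by exact_mod_cast hn
  have h1 := one_add_log_le_logTerm hn hε hδ hδ1
  have h2 := log_one_div_nonneg hε hε1
  have hexp := exp_neg_logTerm hn hε hδ
  have hl0 := truncLevel_pos hε hε1
  have hl := one_div_truncLevel_le hn hε hδ hδ1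
  set lam := truncLevel 64 ε
  set Λ := logTerm n ε δ
  have hΛ : 1 ≤ Λ := by linarith
  have hK0 : 0 ≤ K := le_trans (by positivity) hK
  have hlam : ε / (64 * Λ) ≤ lam := by
    rw [div_le_div_iff₀ hl0 hε] at hl
    rw [div_le_iff₀ (by positivity)]
    linarith
  -- With `lam ≥ ε / (64 * Λ)`, the constant is `163840 = 20 * 64 ^ 2 * 2`; squaring `lam` costs two
  -- of the three powers of `Λ`.
  have hX : 20 * Λ ≤ 2 * K * (lam / 2) ^ 2 / C ^ 2 := by
    calc 20 * Λ = 2 * (163840 * (C ^ 2 / ε ^ 2) * Λ ^ 3) * (ε / (64 * Λ) / 2) ^ 2 / C ^ 2 := by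
          field_simp
          norm_num
      _ ≤ 2 * K * (lam / 2) ^ 2 / C ^ 2 := by gcongr
  have he : Real.exp (-(2 * K * (lam / 2) ^ 2 / C ^ 2)) ≤ (ε * δ / (3 * n)) ^ 20 := by
    rw [← hexp, ← Real.exp_nat_mul]
    refine Real.exp_le_exp.2 ?_
    push_cast
    linarith
  set a := ε * δ / (3 * n) with ha
  have ha0 : 0 ≤ a := by positivity
  have ha1 : a ≤ δ / (3 * n) := by
    rw [ha]
    gcongr
    exact mul_le_of_le_one_left hδ.le hε1.le
  have ha2 : a ≤ ε / 3 := by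
    rw [ha]
    refine div_le_div₀ hε.le (mul_le_of_le_one_right hε.le hδ1.le) (by norm_num) (by linarith)
  have ha3 : a ≤ 1 / 3 := ha2.trans (by linarith)
  -- One factor yields the failure probability, three cancel the `ε ^ 3` in `ρ`, and the others
  -- absorb the numerical constants.
  have h4 : a ^ 20 ≤ δ / (3 * n) * ((ε / 3) ^ 3 * (1 / 3) ^ 16) := by
    calc a ^ 20 = a * (a ^ 3 * a ^ 16) := by ring
      _ ≤ _ := by gcongr
  rw [div_le_iff₀ (by positivity)]
  calc 4 * Real.exp (-(2 * K * (lam / 2) ^ 2 / C ^ 2))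
      ≤ 4 * (δ / (3 * n) * ((ε / 3) ^ 3 * (1 / 3) ^ 16)) := by linarith
    _ = δ / (3 * n) * (ε ^ 3 * (4 / 3 ^ 19)) := by ring
    _ ≤ δ / (3 * n) * (ε ^ 3 / 1024) := by
      refine mul_le_mul_of_nonneg_left ?_ (by positivity)
      rw [div_eq_mul_inv (ε ^ 3)]
      exact mul_le_mul_of_nonneg_left (by norm_num) (by positivity)

/-- The number of features in a sparse combination. -/
noncomputable def sparsity (ε : ℝ) : ℕ := ⌈24 / (truncLevel 64 ε * ε)⌉₊

lemma sparsity_pos (hε : 0 < ε) (hε1 : ε < 1) : 0 < sparsity ε :=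
  Nat.ceil_pos.2 (by have := truncLevel_pos hε hε1; positivity)

lemma sparsity_le (hn : 0 < n) (hε : 0 < ε) (hε1 : ε < 1) (hδ : 0 < δ) (hδ1 : δ < 1) :
    (sparsity ε : ℝ) ≤ 1600 * logTerm n ε δ / ε ^ 2 := by
  have hl0 := truncLevel_pos hε hε1
  have hl1 := truncLevel_le hε hε1
  have hl := one_div_truncLevel_le hn hε hδ hδ1
  have h1 : 1 ≤ 1 / (truncLevel 64 ε * ε) := by
    rw [le_div_iff₀ (by positivity)]
    nlinarith
  calc (sparsity ε : ℝ) ≤ 24 / (truncLevel 64 ε * ε) + 1 :=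
      (Nat.ceil_lt_add_one (by positivity)).le
    _ ≤ 24 * (1 / (truncLevel 64 ε * ε)) + 1 / (truncLevel 64 ε * ε) := by
      rw [mul_one_div]; linarith
    _ = 25 * (1 / truncLevel 64 ε) / ε := by field_simp; norm_num
    _ ≤ 25 * (64 * logTerm n ε δ / ε) / ε := by gcongr
    _ = 1600 * logTerm n ε δ / ε ^ 2 := by ring

/-- The accuracy reached with the chosen parameters. -/
lemma accuracy_le (hε : 0 < ε) (hε1 : ε < 1) :
    2 * (8 * truncLevel 64 ε + ε ^ 3 / 1024 * (2 / truncLevel 64 ε) + 2 * (ε / 16) +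
      3 * ((sparsity ε : ℝ)⁻¹ / truncLevel 64 ε)) ≤ ε := by
  -- Each of the four terms is at most `ε / 8`; the factor 2 from Pinsker completes `ε`.
  have hl0 := truncLevel_pos hε hε1
  have h1 := truncLevel_le hε hε1
  have h2 := one_div_truncLevel_le_sq hε
  have h3 : ε ^ 3 / 1024 * (2 / truncLevel 64 ε) ≤ ε / 8 := by
    calc ε ^ 3 / 1024 * (2 / truncLevel 64 ε) = ε ^ 3 / 512 * (1 / truncLevel 64 ε) := by
          field_simp; norm_num
      _ ≤ ε ^ 3 / 512 * (64 / ε ^ 2) := by gcongr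
      _ = ε / 8 := by field_simp; norm_num
  have h4 : 3 * ((sparsity ε : ℝ)⁻¹ / truncLevel 64 ε) ≤ ε / 8 := by
    have h5 : (sparsity ε : ℝ)⁻¹ ≤ (24 / (truncLevel 64 ε * ε))⁻¹ :=
      inv_anti₀ (by positivity) (Nat.le_ceil _)
    calc 3 * ((sparsity ε : ℝ)⁻¹ / truncLevel 64 ε)
        ≤ 3 * ((24 / (truncLevel 64 ε * ε))⁻¹ / truncLevel 64 ε) := by gcongr
      _ = ε / 8 := by field_simp; norm_num
  linarith

lemma log_feature_bound_le {C : ℝ} (hn : 0 < n) (hε : 0 < ε) (hε1 : ε < 1) (hδ : 0 < δ)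
    (hδ1 : δ < 1) (hC : 1 ≤ C) :
    Real.log (163840 * (C ^ 2 / ε ^ 2) * logTerm n ε δ ^ 3) ≤
      18 * logTerm n ε δ * (1 + Real.log C) := by
  have h1 := one_add_log_le_logTerm hn hε hδ hδ1
  have h2 := log_one_div_nonneg hε hε1
  set Λ := logTerm n ε δ
  have hΛ : 1 ≤ Λ := by linarith
  have hc : Real.log 163840 ≤ 13 := by
    calc Real.log 163840 ≤ Real.log (2 ^ 18) := Real.log_le_log (by norm_num) (by norm_num)
      _ = 18 * Real.log 2 := by rw [Real.log_pow]; norm_num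
      _ ≤ 13 := by linarith [Real.log_two_lt_d9]
  have hlogC : 0 ≤ Real.log C := Real.log_nonneg hC
  have hlogΛ := Real.log_le_sub_one_of_pos (by linarith : 0 < Λ)
  have hC0 : 0 < C := by linarith
  have e : Real.log (163840 * (C ^ 2 / ε ^ 2) * Λ ^ 3) =
      Real.log 163840 + (2 * Real.log C + 2 * Real.log (1 / ε)) + 3 * Real.log Λ := by
    rw [Real.log_mul (by positivity) (by positivity), Real.log_mul (by norm_num) (by positivity),
      Real.log_div (by positivity) (by positivity), Real.log_pow, Real.log_pow, Real.log_pow,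
      one_div, Real.log_inv]
    push_cast
    ring
  rw [e]
  nlinarith [mul_nonneg (sub_nonneg.2 hΛ) hlogC]

/-- The number of cascades suffices for uniform convergence. -/
lemma sample_failure_le {C r : ℝ} {K M a : ℕ} (hn : 0 < n) (hε : 0 < ε) (hε1 : ε < 1) (hδ : 0 < δ)
    (hδ1 : δ < 1) (hC : 1 ≤ C) (hr : 0 < r) (hK0 : 0 < K)
    (hK : (K : ℝ) ≤ (163840 * (C ^ 2 / ε ^ 2) * logTerm n ε δ ^ 3) ^ a)
    (hM : 51200 * (28800 * a + 3) * ((1 + Real.log C) / (ε ^ 4 * r ^ 2)) * logTerm n ε δ ^ 4 ≤ M) :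
    ((K : ℝ) ^ sparsity ε + 1) *
        Real.exp (-(2 * M * (ε / 16) ^ 2 / (4 * (1 / r) * Real.log (1 / truncLevel 64 ε)) ^ 2)) +
      Real.exp (-(2 * M * r ^ 2)) ≤ δ / (3 * n) := by
  have hn1 : (1 : ℝ) ≤ n := by exact_mod_cast hn
  have h1 := one_add_log_le_logTerm hn hε hδ hδ1
  have h2 := log_one_div_nonneg hε hε1
  have hexp := exp_neg_logTerm hn hε hδ
  have hl0 := truncLevel_pos hε hε1
  have hl1 := truncLevel_le hε hε1
  have hlog := log_one_div_truncLevel_le hn hε hε1 hδ hδ1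
  have hm := sparsity_le hn hε hε1 hδ hδ1
  have hb := log_feature_bound_le hn hε hε1 hδ hδ1 hC
  have hlog0 : 0 < Real.log (1 / truncLevel 64 ε) :=
    Real.log_pos (by rw [lt_div_iff₀ hl0]; linarith)
  set lam := truncLevel 64 ε
  set Λ := logTerm n ε δ
  set Lg := Real.log (1 / lam)
  set m := sparsity ε
  have hΛ : 1 ≤ Λ := by linarith
  have hlogC : 0 ≤ Real.log C := Real.log_nonneg hC
  have hKpos : (0 : ℝ) < K := by exact_mod_cast hK0
  have hlogK : Real.log K ≤ a * (18 * Λ * (1 + Real.log C)) := by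
    refine (Real.log_le_log hKpos hK).trans ?_
    rw [Real.log_pow]
    gcongr
  have hlogK0 : 0 ≤ Real.log K := Real.log_nonneg (by exact_mod_cast hK0)
  set X := 2 * M * (ε / 16) ^ 2 / (4 * (1 / r) * Lg) ^ 2 with hX
  -- Here `28800 = 1600 * 18` comes from the bounds on `m` and `log K`, and `51200 = 16 ^ 2 * (4 *
  -- 5) ^ 2 / 2` from the deviation `ε / 16` and the range of the loss.
  have hXlow : m * Real.log K + 3 * Λ ≤ X := by
    have hε2 : 1 ≤ 1 / ε ^ 2 := by
      rw [le_div_iff₀ (by positivity), one_mul]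
      exact pow_le_one₀ hε.le hε1.le
    have hc1 : 1 ≤ Λ * (1 + Real.log C) / ε ^ 2 := by
      rw [le_div_iff₀ (by positivity), one_mul]
      have : ε ^ 2 ≤ 1 := pow_le_one₀ hε.le hε1.le
      nlinarith
    calc m * Real.log K + 3 * Λ
        ≤ 1600 * Λ / ε ^ 2 * (a * (18 * Λ * (1 + Real.log C))) +
          3 * Λ * (Λ * (1 + Real.log C) / ε ^ 2) := by
          refine add_le_add (mul_le_mul hm hlogK hlogK0 (by positivity)) ?_
          exact le_mul_of_one_le_right (by positivity) hc1
      _ = 2 * (51200 * (28800 * a + 3) * ((1 + Real.log C) / (ε ^ 4 * r ^ 2)) * Λ ^ 4) *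
          (ε / 16) ^ 2 / (4 * (1 / r) * (5 * Λ)) ^ 2 := by
          field_simp
          ring
      _ ≤ X := by
          rw [hX]
          gcongr
  have hMr : 3 * Λ ≤ 2 * M * r ^ 2 := by
    have hΛ3 : 1 ≤ Λ ^ 3 := one_le_pow₀ hΛ
    have hε4 : 1 ≤ 1 / ε ^ 4 := by
      rw [le_div_iff₀ (by positivity), one_mul]
      exact pow_le_one₀ hε.le hε1.le
    have ha : (0 : ℝ) ≤ a := Nat.cast_nonneg a
    calc 3 * Λ ≤ 2 * (51200 * (28800 * a + 3)) * Λ := by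
          refine mul_le_mul_of_nonneg_right ?_ (by linarith)
          linarith
      _ ≤ 2 * (51200 * (28800 * a + 3)) * Λ * (Λ ^ 3 * (1 / ε ^ 4) * (1 + Real.log C)) := by
          refine le_mul_of_one_le_right (by positivity) ?_
          exact one_le_mul_of_one_le_of_one_le (one_le_mul_of_one_le_of_one_le hΛ3 hε4)
            (by linarith)
      _ = 2 * (51200 * (28800 * a + 3) * ((1 + Real.log C) / (ε ^ 4 * r ^ 2)) * Λ ^ 4) *
          r ^ 2 := by
          field_simp
      _ ≤ 2 * M * r ^ 2 := by gcongr
  have e1 : (K : ℝ) ^ m * Real.exp (-X) ≤ Real.exp (-(3 * Λ)) := by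
    rw [← Real.exp_log hKpos, ← Real.exp_nat_mul, ← Real.exp_add]
    exact Real.exp_le_exp.2 (by linarith)
  have e2 : Real.exp (-X) ≤ Real.exp (-(3 * Λ)) := by
    refine Real.exp_le_exp.2 ?_
    have : 0 ≤ (m : ℝ) * Real.log K := by positivity
    linarith
  have e3 : Real.exp (-(2 * M * r ^ 2)) ≤ Real.exp (-(3 * Λ)) := Real.exp_le_exp.2 (by linarith)
  have e4 : Real.exp (-(3 * Λ)) = (ε * δ / (3 * n)) ^ 3 := by
    rw [← hexp, ← Real.exp_nat_mul]
    push_cast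
    ring_nf
  set x := ε * δ / (3 * n) with hx
  have hx0 : 0 ≤ x := by positivity
  have hx1 : x ≤ δ / (3 * n) := by
    rw [hx]
    gcongr
    exact mul_le_of_le_one_left hδ.le hε1.le
  have hx2 : x ≤ 1 / 3 := by
    rw [hx]
    exact div_le_div₀ zero_le_one (mul_le_one₀ hε1.le hδ.le hδ1.le) (by norm_num) (by linarith)
  have hx3 : 3 * x ^ 3 ≤ x := by nlinarith [mul_nonneg hx0 hx0]
  rw [add_one_mul]
  linarith

end Parameters

/-! ### Accuracy for all nodes -/

lemma prob_eq_one {α : Type*} [Fintype α] (p : PMF α) {e : α → Prop} (h : ∀ x, e x) :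
    prob p e = 1 := by
  classical
  rw [prob_eq_expect]
  simp [h, expect_const]

/-- A union bound over the nodes: each fails with probability at most `δ / (3 * n)` through its
features and as much through the sample, in total `2 / 3 * δ`. -/
theorem accuracy_of_features {n : ℕ} {E : Finset (Fin n × Fin n)}
    {D : Finset (Fin n) → PMF (Finset (Fin n))} {Γ : Fin n → PMF (Finset (Fin n × Fin n))}
    (hΓ : ∀ v, IsLiveEdgeDist E D v (Γ v)) {q : Fin n → PMF (Finset (Fin n))} {C : ℝ}
    (hq : ∀ v T, (reachDist (Γ v) v T).toReal ≤ C * (q v T).toReal)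
    (P : PMF (Finset (Fin n))) {r : I} {ε δ : ℝ} (hr : 0 < r) (hε : 0 < ε) (hε1 : ε < 1)
    (hδ : 0 < δ) (hδ1 : δ < 1) {a K M : ℕ}
    (hK : 163840 * (C ^ 2 / ε ^ 2) * logTerm n ε δ ^ 3 ≤ K)
    (hK' : (K : ℝ) ≤ (163840 * (C ^ 2 / ε ^ 2) * logTerm n ε δ ^ 3) ^ a)
    (hM : 51200 * (28800 * a + 3) * ((1 + Real.log C) / (ε ^ 4 * (r : ℝ) ^ 2)) *
      logTerm n ε δ ^ 4 ≤ M) :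
    1 - δ ≤ prob (experiment P D r q M K) (fun x => ∀ v,
      (∃ β, IsFit (r : ℝ) (truncLevel 64 ε) (x.2 v) x.1 v β) ∧
      ∀ β, IsFit (r : ℝ) (truncLevel 64 ε) (x.2 v) x.1 v β →
        expect P (fun S =>
          (truncFun (truncLevel 64 ε) (x.2 v) β S - influence D S v) ^ 2) ≤ ε) := by
  rcases Nat.eq_zero_or_pos n with rfl | hn
  · rw [prob_eq_one _ fun x v => v.elim0]
    linarith
  have hn0 : (0 : ℝ) < n := Nat.cast_pos.2 hn
  have hr0 : (0 : ℝ) < r := hr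
  have hC : 1 ≤ C := one_le_of_le_mul (hq ⟨0, hn⟩)
  have hlogC : 0 ≤ Real.log C := Real.log_nonneg hC
  have hC0 : 0 < C := by linarith
  have hΛ : 0 < logTerm n ε δ := by
    linarith [one_add_log_le_logTerm hn hε hδ hδ1, log_one_div_nonneg hε hε1]
  have hK0 : 0 < K := by
    rw [← Nat.cast_pos (α := ℝ)]
    exact lt_of_lt_of_le (by positivity) hK
  have hM0 : 0 < M := by
    rw [← Nat.cast_pos (α := ℝ)]
    exact lt_of_lt_of_le (by positivity) hM
  have hl0 := truncLevel_pos hε hε1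
  have hl1 : truncLevel 64 ε < 1 / 2 := by linarith [truncLevel_le hε hε1]
  have hρ0 : 0 < ε ^ 3 / 1024 := by positivity
  have hρ : ε ^ 3 / 1024 < 1 := by
    have : ε ^ 3 ≤ 1 := pow_le_one₀ hε.le hε1.le
    linarith
  have node : ∀ v, prob (experiment P D r q M K) (fun x =>
      ¬ ∀ β, IsFit (r : ℝ) (truncLevel 64 ε) (x.2 v) x.1 v β →
        expect P (fun S => (truncFun (truncLevel 64 ε) (x.2 v) β S - influence D S v) ^ 2) ≤
          ε) ≤ δ / (3 * n) + δ / (3 * n) := by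
    intro v
    have h1 := prob_experiment_inaccurate_le (P := P) (D := D) (q := q) (v := v)
      (t := ε / 16) (m := sparsity ε) (fun S => (hΓ v).influence_eq S)
      (fun T hT => mem_of_reachDist_ne_zero hT) (hΓ v).influence_eq_one (hq v) hr hl0 hl1
      hρ0 hρ (by positivity) (sparsity_pos hε hε1) hM0 hK0
    refine le_trans (prob_mono _ ?_) (h1.trans (add_le_add ?_ ?_))
    · exact fun x hx hx' => hx fun β hβ => (hx' β hβ).trans (accuracy_le hε hε1)
    · exact feature_failure_le hn hε hε1 hδ hδ1 hC hK
    · exact sample_failure_le hn hε hε1 hδ hδ1 hC hr0 hK0 hK' hM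
  have total := (prob_exists_le (experiment P D r q M K) _).trans
    (Finset.sum_le_sum fun v (_ : v ∈ Finset.univ) => node v)
  have hsum : ∑ _v : Fin n, (δ / (3 * n) + δ / (3 * n)) ≤ δ := by
    rw [Finset.sum_const, Finset.card_univ, Fintype.card_fin, nsmul_eq_mul]
    have : (n : ℝ) * (δ / (3 * n) + δ / (3 * n)) = 2 / 3 * δ := by
      field_simp
      norm_num
    linarith
  have compl := prob_not (experiment P D r q M K) (fun x => ∃ v,
      ¬ ∀ β, IsFit (r : ℝ) (truncLevel 64 ε) (x.2 v) x.1 v β →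
        expect P (fun S =>
          (truncFun (truncLevel 64 ε) (x.2 v) β S - influence D S v) ^ 2) ≤ ε)
  refine le_trans ?_ (prob_mono _ fun x hx v => ⟨exists_isFit hK0 hl0 hl1.le _ _ _,
    not_not.1 (not_exists.1 hx v)⟩)
  rw [compl]
  linarith

/-! ### The learner -/

section Learner

open Classical in
/-- A maximizer of the noise-corrected log-likelihood. -/
noncomputable def fitWeights {V : Type*} [Fintype V] [DecidableEq V] {K M : ℕ} (r lam : ℝ)
    (T : Fin K → Finset V) (s : Fin M → Finset V × Finset V) (v : V) : Fin K → ℝ :=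
  if h : ∃ β, IsFit r lam T s v β then h.choose else 0

lemma isFit_fitWeights {V : Type*} [Fintype V] [DecidableEq V] {K M : ℕ} (hK : 0 < K)
    {r lam : ℝ} (h0 : 0 < lam) (h1 : lam ≤ 1 / 2) (T : Fin K → Finset V)
    (s : Fin M → Finset V × Finset V) (v : V) : IsFit r lam T s v (fitWeights r lam T s v) := by
  have h := exists_isFit hK (r := r) h0 h1 T s v
  rw [fitWeights, dif_pos h]
  exact h.choose_spec

/-- The number of features that suffices for uniformly distributed features. -/
noncomputable def uniformFeatureCount (n : ℕ) (ε δ : ℝ) : ℕ :=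
  ⌈163840 * (((2 : ℝ) ^ n) ^ 2 / ε ^ 2) * logTerm n ε δ ^ 3⌉₊ + 1

/-- The law of uniformly distributed features. -/
noncomputable def uniformFeatures (n : ℕ) (_ : Fin n) : PMF (Finset (Fin n)) :=
  PMF.uniformOfFintype (Finset (Fin n))

lemma le_mul_uniformFeatures {n : ℕ} (v : Fin n) (γ : PMF (Finset (Fin n)))
    (T : Finset (Fin n)) : (γ T).toReal ≤ 2 ^ n * (uniformFeatures n v T).toReal := by
  rw [uniformFeatures, PMF.uniformOfFintype_apply, Fintype.card_finset, Fintype.card_fin,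
    ENNReal.toReal_inv]
  push_cast
  rw [ENNReal.toReal_pow, ENNReal.toReal_ofNat, mul_inv_cancel₀ (by positivity)]
  exact ENNReal.toReal_le_of_le_ofReal zero_le_one (by simpa using γ.coe_le_one T)

/-- The function computed from a training set and features. -/
noncomputable def fittedFunction {V : Type*} [Fintype V] [DecidableEq V] {K M : ℕ} (r lam : ℝ)
    (s : Fin M → Finset V × Finset V) (T : V → Fin K → Finset V) (S : Finset V) (v : V) : ℝ :=
  truncFun lam (T v) (fitWeights r lam (T v) s v) S

/-- The truncated maximum-likelihood learner with uniformly distributed features. -/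
noncomputable def uniformLearner : Learner := fun n _ r ε δ _ s =>
  (featureLaw (uniformFeatures n) (uniformFeatureCount n (ε / 2) δ)).map
    (fittedFunction (r : ℝ) (truncLevel 64 (ε / 2)) s)

lemma truncLevel_half_mem {ε : ℝ} (hε : 0 < ε) (hε1 : ε < 1) :
    0 < truncLevel 64 (ε / 2) ∧ truncLevel 64 (ε / 2) < 1 / 2 := by
  have h1 := truncLevel_le (half_pos hε) (by linarith : ε / 2 < 1)
  exact ⟨truncLevel_pos (half_pos hε) (by linarith), by linarith⟩

lemma uniformLearner_isTruncatedML : uniformLearner.IsTruncatedML := by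
  intro n E r ε δ _ hε hε1 _ _
  obtain ⟨h0, h1⟩ := truncLevel_half_mem hε hε1
  exact ⟨uniformFeatures n, uniformFeatureCount n (ε / 2) δ, truncLevel 64 (ε / 2),
    Nat.succ_pos _, h0, h1, fun M s => ⟨fun T v => fitWeights r _ (T v) s v,
      fun T v => isFit_fitWeights (Nat.succ_pos _) h0 h1.le _ _ _, rfl⟩⟩

lemma reachFun_empty {V : Type*} [Fintype V] [DecidableEq V] {K : ℕ} (T : Fin K → Finset V)
    (β : Fin K → ℝ) : reachFun T β ∅ = 0 := by
  simp [reachFun_eq, hit_eq]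

/-- The outputs of the learner take a positive value at the empty seed set. -/
lemma not_isProper_uniformLearner (m : Model) : ¬ uniformLearner.IsProper m := by
  intro h
  obtain ⟨F, hF⟩ := (uniformLearner 1 ∅ 1 (1 / 2) (1 / 2) 0 Fin.elim0).support_nonempty
  obtain ⟨D, hD, rfl⟩ := h 1 ∅ 1 (1 / 2) (1 / 2) one_pos (by norm_num) (by norm_num)
    (by norm_num) (by norm_num) 0 Fin.elim0 F hF
  rw [uniformLearner, PMF.mem_support_map_iff] at hF
  obtain ⟨T, _, hT⟩ := hF
  obtain ⟨Γ, hΓ⟩ := exists_isLiveEdgeDist ∅ m hD (0 : Fin 1)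
  have h1 := congrFun (congrFun hT ∅) 0
  rw [hΓ.influence_empty, fittedFunction, truncFun, reachFun_empty, mul_zero, zero_add] at h1
  exact (truncLevel_half_mem (by norm_num) (by norm_num)).1.ne' h1

/-- The influence is the mean of the activation indicator, so the cross term of the bias-variance
decomposition vanishes. -/
lemma errSq_sub_errSq {V : Type*} [Fintype V] [DecidableEq V] (P : PMF (Finset V))
    (D : Finset V → PMF (Finset V)) (F : Finset V → V → ℝ) :
    errSq P D F - errSq P D (influence D) =
      (1 / (Fintype.card V : ℝ)) * ∑ v, expect P fun S => (F S v - influence D S v) ^ 2 := by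
  have h : ∀ S v, expect (D S) (fun A => ((if v ∈ A then 1 else 0) - F S v) ^ 2) -
      expect (D S) (fun A => ((if v ∈ A then 1 else 0) - influence D S v) ^ 2) =
        (F S v - influence D S v) ^ 2 := by
    intro S v
    have e : ∀ A : Finset V, ((if v ∈ A then (1 : ℝ) else 0) - F S v) ^ 2 -
        ((if v ∈ A then 1 else 0) - influence D S v) ^ 2 =
        2 * (influence D S v - F S v) * (if v ∈ A then 1 else 0) +
          (F S v ^ 2 - influence D S v ^ 2) := by
      intro A; ring
    rw [← expect_sub]
    simp only [e]
    rw [expect_add, expect_const_mul, expect_const, ← prob_eq_expect,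
      show prob (D S) (fun A => v ∈ A) = influence D S v from rfl]
    ring
  rw [errSq, errSq]
  simp only [expect_const_mul, expect_sum]
  rw [← mul_sub, ← Finset.sum_sub_distrib]
  congr 1
  refine Finset.sum_congr rfl fun v _ => ?_
  rw [← expect_sub]
  simp only [h]

lemma bind_uniformLearner {n : ℕ} (E : Finset (Fin n × Fin n)) (r : I) (ε δ : ℝ)
    (P : PMF (Finset (Fin n))) (D : Finset (Fin n) → PMF (Finset (Fin n))) (M : ℕ) :
    (trainingSet P D r M).bind (uniformLearner n E r ε δ M) =
      (experiment P D r (uniformFeatures n) M (uniformFeatureCount n (ε / 2) δ)).map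
        fun x => fittedFunction (r : ℝ) (truncLevel 64 (ε / 2)) x.1 x.2 := by
  rw [experiment, PMF.map_bind]
  congr 1
  ext1 s
  rw [PMF.map_comp]
  rfl

/-- The exponent 2 leaves room for the rounding and the added feature, since `x + 2 ≤ x ^ 2` for
large `x`. -/
lemma uniformFeatureCount_le {n : ℕ} (hn : 0 < n) {ε δ : ℝ} (hε : 0 < ε) (hε1 : ε < 1)
    (hδ : 0 < δ) (hδ1 : δ < 1) : (uniformFeatureCount n ε δ : ℝ) ≤
      (163840 * (((2 : ℝ) ^ n) ^ 2 / ε ^ 2) * logTerm n ε δ ^ 3) ^ 2 := by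
  have h1 := one_add_log_le_logTerm hn hε hδ hδ1
  have h2 := log_one_div_nonneg hε hε1
  have h3 : 1 ≤ ((2 : ℝ) ^ n) ^ 2 / ε ^ 2 := by
    rw [le_div_iff₀ (by positivity), one_mul]
    exact (pow_le_one₀ hε.le hε1.le).trans (one_le_pow₀ (one_le_pow₀ one_le_two))
  have h4 : 1 ≤ logTerm n ε δ ^ 3 := one_le_pow₀ (by linarith)
  set x := 163840 * (((2 : ℝ) ^ n) ^ 2 / ε ^ 2) * logTerm n ε δ ^ 3 with hx
  have h5 : 163840 ≤ x := by
    rw [hx, mul_assoc]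
    exact le_mul_of_one_le_right (by norm_num) (one_le_mul_of_one_le_of_one_le h3 h4)
  have h6 := Nat.ceil_lt_add_one (by linarith : 0 ≤ x)
  rw [uniformFeatureCount]
  push_cast
  nlinarith

/-- The sample size required by the accuracy guarantee is polynomially bounded. -/
lemma sample_size_le {n e c : ℕ} (hc : 51200 * 57603 * 41472 ≤ (c : ℝ)) (hn : 0 < n) {ε δ r : ℝ}
    (hε : 0 < ε) (hε1 : ε < 1)
    (hδ : 0 < δ) (hδ1 : δ < 1) (hr : 0 < r) :
    51200 * (28800 * (2 : ℕ) + 3) * ((1 + Real.log (2 ^ n)) / ((ε / 2) ^ 4 * r ^ 2)) *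
        logTerm n (ε / 2) δ ^ 4 ≤
      c * (n + e + 1 / ε + 1 / δ + 1 / r) ^ 19 := by
  have hn1 : (1 : ℝ) ≤ n := by exact_mod_cast hn
  have pe : 0 < 1 / ε := by positivity
  have pd : 0 < 1 / δ := by positivity
  have pr : 0 < 1 / r := by positivity
  have pE : (0 : ℝ) ≤ e := Nat.cast_nonneg e
  set x := (n + e + 1 / ε + 1 / δ + 1 / r : ℝ)
  have xn : (n : ℝ) ≤ x := by linarith
  have xe : 1 / ε ≤ x := by linarith
  have xd : 1 / δ ≤ x := by linarith
  have xr : 1 / r ≤ x := by linarith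
  have x1 : 1 ≤ x := hn1.trans xn
  clear_value x
  have hlog : 1 + Real.log (2 ^ n) ≤ 2 * x := by
    rw [Real.log_pow]
    nlinarith [Real.log_two_lt_d9, Real.log_two_gt_d9]
  have hlog0 : 0 ≤ 1 + Real.log (2 ^ n) := by
    have := Real.log_nonneg (one_le_pow₀ one_le_two : (1 : ℝ) ≤ 2 ^ n)
    linarith
  have e1 : 3 * n / (ε / 2 * δ) = 6 * (n * (1 / ε) * (1 / δ)) := by
    field_simp
    norm_num
  have hΛ : logTerm n (ε / 2) δ ≤ 6 * x ^ 3 := by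
    have h1 := Real.log_le_sub_one_of_pos
      (by positivity : (0 : ℝ) < 3 * n / (ε / 2 * δ))
    have h2 : (n : ℝ) * (1 / ε) * (1 / δ) ≤ x * x * x := by gcongr
    rw [e1] at h1
    rw [logTerm, e1]
    calc _ ≤ 6 * ((n : ℝ) * (1 / ε) * (1 / δ)) := by linarith
      _ ≤ 6 * (x * x * x) := by linarith
      _ = 6 * x ^ 3 := by ring
  have hΛ0 : 0 ≤ logTerm n (ε / 2) δ := by
    linarith [one_add_log_le_logTerm hn (half_pos hε) hδ hδ1,
      log_one_div_nonneg (half_pos hε) (by linarith : ε / 2 < 1)]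
  -- The degrees add up as `1 + 4 + 2 + 3 * 4 = 19`, the constants as `2 * 16 * 6 ^ 4 = 41472`.
  calc 51200 * (28800 * (2 : ℕ) + 3) * ((1 + Real.log (2 ^ n)) / ((ε / 2) ^ 4 * r ^ 2)) *
        logTerm n (ε / 2) δ ^ 4
      = 51200 * 57603 * ((1 + Real.log (2 ^ n)) * (16 * (1 / ε) ^ 4 * (1 / r) ^ 2)) *
        logTerm n (ε / 2) δ ^ 4 := by
        generalize 1 + Real.log (2 ^ n) = y
        push_cast
        field_simp
        norm_num
        ring
    _ ≤ 51200 * 57603 * (2 * x * (16 * x ^ 4 * x ^ 2)) * (6 * x ^ 3) ^ 4 := by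
        gcongr
    _ = 51200 * 57603 * 41472 * x ^ 19 := by ring
    _ ≤ c * x ^ 19 := by gcongr

/-- The number of features is exponential in `n`, but the required sample grows only with `log (2 ^
n)`. Accuracy `ε / 2` is used because an excess error equal to `ε` already counts as failure. -/
theorem uniformLearner_pacLearns (m : Model) : uniformLearner.PACLearns m := by
  obtain ⟨c, hc⟩ := exists_nat_ge (51200 * 57603 * 41472 : ℝ)
  refine ⟨c, 19, fun n E r ε δ hr hε hε1 hδ hδ1 D hD P M hM => ?_⟩
  have hM' := fun hn : 0 < n => (sample_size_le hc hn hε hε1 hδ hδ1 hr).trans hM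
  clear hM
  rw [bind_uniformLearner, prob_map]
  rcases Nat.eq_zero_or_pos n with rfl | hn
  -- Without nodes the excess error is an empty sum, so it never reaches `ε`.
  · refine (prob_mono _ (e' := fun _ => ¬ True) fun x hx => ?_).trans ?_
    · rw [errSq_sub_errSq] at hx
      simp at hx
      linarith
    · rw [prob_not, prob_eq_one _ fun _ => trivial]
      linarith
  choose Γ hΓ using exists_isLiveEdgeDist E m hD
  have hε' := half_pos hε
  have hε1' : ε / 2 < 1 := by linarith
  obtain ⟨h0, h1⟩ := truncLevel_half_mem hε hε1
  have key := accuracy_of_features hΓ (fun v T => le_mul_uniformFeatures v _ T) P hr hε' hε1'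
    hδ hδ1 (a := 2) (K := uniformFeatureCount n (ε / 2) δ) (M := M)
    ((Nat.le_ceil _).trans (by rw [uniformFeatureCount]; push_cast; linarith))
    (uniformFeatureCount_le hn hε' hε1' hδ hδ1) (hM' hn)
  have hn0 : (0 : ℝ) < n := Nat.cast_pos.2 hn
  rw [sub_le_comm, ← prob_not] at key
  refine le_trans (prob_mono _ fun x hx hgood => ?_) key
  rw [errSq_sub_errSq, Fintype.card_fin] at hx
  have hsum := Finset.sum_le_sum fun v (_ : v ∈ Finset.univ) =>
    (hgood v).2 _ (isFit_fitWeights (Nat.succ_pos _) h0 h1.le (x.2 v) x.1 v)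
  have hsum' : ∑ _v : Fin n, ε / 2 = n * (ε / 2) := by simp
  rw [hsum'] at hsum
  have : (1 / (n : ℝ)) * ∑ v, expect P (fun S =>
      (fittedFunction (r : ℝ) (truncLevel 64 (ε / 2)) x.1 x.2 S v - influence D S v) ^ 2) ≤
      1 / n * (n * (ε / 2)) := mul_le_mul_of_nonneg_left hsum (by positivity)
  rw [one_div, inv_mul_cancel_left₀ hn0.ne'] at this
  rw [one_div] at hx
  linarith

end Learner

end Influence

theorem theorem3 :
    (∀ (n : ℕ) (E : Finset (Fin n × Fin n)) (m : Model), ∀ D ∈ m.instances E,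
      ∀ v, ∃ Γ, IsLiveEdgeDist E D v Γ) ∧
    (∃ c₀ c₁ : ℝ, ∃ p₁ : ℕ, 2 < c₀ ∧ 0 < c₁ ∧ ∀ a : ℕ, ∃ c₂ : ℝ, ∃ p₂ : ℕ, 0 < c₂ ∧
      ∀ (n : ℕ) (E : Finset (Fin n × Fin n)) (m : Model), ∀ D ∈ m.instances E,
      ∀ Γ : Fin n → PMF (Finset (Fin n × Fin n)), (∀ v, IsLiveEdgeDist E D v (Γ v)) →
      ∀ (q : Fin n → PMF (Finset (Fin n))) (C : ℝ),
        (∀ v T, (reachDist (Γ v) v T).toReal ≤ C * (q v T).toReal) →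
      ∀ (P : PMF (Finset (Fin n))) (r : I) (ε δ : ℝ),
        0 < r → 0 < ε → ε < 1 → 0 < δ → δ < 1 →
      ∀ K M : ℕ,
        c₁ * (C ^ 2 / ε ^ 2) * logTerm n ε δ ^ p₁ ≤ K →
        (K : ℝ) ≤ (c₁ * (C ^ 2 / ε ^ 2) * logTerm n ε δ ^ p₁) ^ a →
        c₂ * ((1 + Real.log C) / (ε ^ 4 * (r : ℝ) ^ 2)) * logTerm n ε δ ^ p₂ ≤ M →
        1 - δ ≤ prob (experiment P D r q M K) (fun x => ∀ v,
          (∃ β, IsFit (r : ℝ) (truncLevel c₀ ε) (x.2 v) x.1 v β) ∧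
          ∀ β, IsFit (r : ℝ) (truncLevel c₀ ε) (x.2 v) x.1 v β →
            expect P (fun S =>
              (truncFun (truncLevel c₀ ε) (x.2 v) β S - influence D S v) ^ 2) ≤ ε)) ∧
    (∃ L : Learner, L.IsTruncatedML ∧ ∀ m : Model, L.PACLearns m ∧ ¬ L.IsProper m) := by
  refine ⟨fun n E m D hD v => exists_isLiveEdgeDist E m hD v,
    ⟨64, 163840, 3, by norm_num, by norm_num, fun a => ⟨51200 * (28800 * a + 3), 4, by positivity,
      fun n E m D _ Γ hΓ q C hq P r ε δ hr hε hε1 hδ hδ1 K M hK hK' hM =>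
        accuracy_of_features hΓ hq P hr hε hε1 hδ hδ1 hK hK' hM⟩⟩,
    uniformLearner, uniformLearner_isTruncatedML,
    fun m => ⟨uniformLearner_pacLearns m, not_isProper_uniformLearner m⟩⟩
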